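/- Let $(M,g)$ be an $n$-dimensional smooth pseudo-Riemannian manifold of Lorentzian signature $(n-1,1)$ with Levi-Civita connection $\nabla$ and curvature tensor $R$. Let $V\subset M$ be a lightlike hypersurface, that is, a smooth (immersed) hypersurface, $\dim V=n-1$, such that $g$ is degenerate on every tangent hyperplane $T_pV$. Suppose that $V$ is totally geodesic: for every $p\in V$ and $v\in T_pV$, the geodesic of $(M,g)$ with initial velocity $v$ lies in $V$ for a short time. Then the following hold. (1) The second fundamental tensor of $V$ vanishes: $g(\nabla_xY,\xi)=0$ for every $p\in V$, every isotropic vector $\xi\in T_pV$, every $x\in T_pV$ and every vector field $Y$ tangent to $V$ and differentiable at $p$. (2) The isotropic sectional curvature of $V$ vanishes: for every $p\in V$, every isotropic vector $N\ne0$ in $T_pV$ and every nonisotropic vector $P\in T_pV$, $$K_N(\sigma)=\frac{g(R(P,N)N,P)}{g(P,P)}=0,\qquad \sigma=\mathrm{span}(N,P).$$ (3) Let an isotropic normalization of $V$ be given, that is, a smooth field $p\mapsto \ell_p\subset T_pM$ of isotropic straight lines along $V$ with $\ell_p\not\subset T_pV$. Then it induces an affine connection on $V$: there is a smooth affine connection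 $\nabla^V$ on $V$, unique in its values on differentiable vector fields, such that for all $p\in V$, $x\in T_pV$ and all vector fields $Y$ on $V$ differentiable at $p$, the vector $\nabla^V_xY$ is the projection of $\nabla_xY$ to $T_pV$ along $\ell_p$. Its curvature tensor $R^V$ is completely determined by the curvature tensor of $(M,g)$: for all $p\in V$ and $x,y,z\in T_pV$, $$R^V(x,y)z=R(x,y)z .$$ -/

import Mathlib

open Bundle FiberBundle Set Filter Topology Manifold ContDiff Module

set_option linter.unusedSectionVars false

noncomputable section

/-- A Lorentzian metric on the manifold `M` (modelled on the finite-dimensional space `E`, without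
boundary): a smooth field of symmetric bilinear forms on the tangent spaces, of signature
`(n - 1, 1)` with `n = dim M`. The signature is expressed by a timelike vector on whose orthogonal
complement the form is positive definite. -/
structure LorentzMetric (E : Type*) [NormedAddCommGroup E] [NormedSpace ℝ E]
    (M : Type*) [TopologicalSpace M] [ChartedSpace E M] [IsManifold 𝓘(ℝ, E) ∞ M] where
  /-- the scalar product on each tangent space -/
  val (x : M) : TangentSpace 𝓘(ℝ, E) x →L[ℝ] TangentSpace 𝓘(ℝ, E) x →L[ℝ] ℝ
  symm (x : M) (v w : TangentSpace 𝓘(ℝ, E) x) : val x v w = val x w v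
  signature (x : M) : ∃ t : TangentSpace 𝓘(ℝ, E) x, val x t t < 0 ∧
    ∀ v : TangentSpace 𝓘(ℝ, E) x, v ≠ 0 → val x t v = 0 → 0 < val x v v
  contMDiff : ContMDiff 𝓘(ℝ, E) (𝓘(ℝ, E).prod 𝓘(ℝ, E →L[ℝ] E →L[ℝ] ℝ)) ∞
    (fun x ↦ TotalSpace.mk' (E →L[ℝ] E →L[ℝ] ℝ)
      (E := fun x : M ↦ TangentSpace 𝓘(ℝ, E) x →L[ℝ] TangentSpace 𝓘(ℝ, E) x →L[ℝ] ℝ) x (val x))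

namespace LorentzMetric

variable {E : Type*} [NormedAddCommGroup E] [NormedSpace ℝ E]
  {M : Type*} [TopologicalSpace M] [ChartedSpace E M] [IsManifold 𝓘(ℝ, E) ∞ M]

/-- The components `g_{ij}` of the metric near `x₀`, in the chart at `x₀`, as a bilinear form on
the model space `E` that depends on the point `y`. -/
def inChart (g : LorentzMetric E M) (x₀ y : M) : E →L[ℝ] E →L[ℝ] ℝ :=
  letI t : E →L[ℝ] E := (trivializationAt E (TangentSpace 𝓘(ℝ, E)) x₀).symmL ℝ y
  letI b : E →L[ℝ] E →L[ℝ] ℝ := g.val y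
  b.bilinearComp t t

/-- The first derivatives `∂_k g_{ij}` at `x₀` in the chart at `x₀`. -/
def dInChart (g : LorentzMetric E M) (x₀ : M) : E →L[ℝ] E →L[ℝ] E →L[ℝ] ℝ :=
  mvfderiv 𝓘(ℝ, E) (g.inChart x₀) x₀

/-- Twice the Christoffel symbols of the first kind at `x₀` in the chart at `x₀`: the bilinear form
`(u, w) ↦ ∂_u g(v, w) + ∂_v g(u, w) - ∂_w g(v, u)`. -/
def christoffelFirst (g : LorentzMetric E M) (x₀ : M) (v : E) : E →L[ℝ] E →L[ℝ] ℝ :=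
  (g.dInChart x₀).flip v + g.dInChart x₀ v - ((g.dInChart x₀).flip v).flip

/-- The Christoffel symbols of `g` at `x₀` in the chart at `x₀`: the linear map `u ↦ Γ(u, v)` with
`g(Γ(u, v), w) = (∂_u g(v, w) + ∂_v g(u, w) - ∂_w g(v, u)) / 2`. -/
def christoffel (g : LorentzMetric E M) (x₀ : M) (v : E) : E →L[ℝ] E :=
  (1 / 2 : ℝ) • (g.inChart x₀ x₀).inverse.comp (g.christoffelFirst x₀ v)


/-- The coordinates of the vectors near `x₀` in the chart at `x₀`. -/
def _root_.tangentCoord (x₀ : M) (w : TangentBundle 𝓘(ℝ, E) M) : E :=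
  (trivializationAt E (TangentSpace 𝓘(ℝ, E)) x₀ w).2

lemma _root_.tangentCoord_self (x : M) (v : TangentSpace 𝓘(ℝ, E) x) :
    tangentCoord x (⟨x, v⟩ : TangentBundle 𝓘(ℝ, E) M) = v := by
  exact tangentCoordChange_self (I := 𝓘(ℝ, E)) (x := x) (z := x) (v := v) (mem_extChartAt_source x)

lemma symmL_self (x : M) (v : TangentSpace 𝓘(ℝ, E) x) :
    (trivializationAt E (TangentSpace 𝓘(ℝ, E)) x).symmL ℝ x v = v := by
  have h := extend_apply_self E v
  have h2 := tangentCoord_self x v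
  simp only [extend] at h
  simp only [tangentCoord] at h2
  erw [h2] at h
  exact (Trivialization.symmL_apply (R := ℝ) (F := E) _ (mem_baseSet_trivializationAt' x) v).trans h

lemma inChart_self (g : LorentzMetric E M) (x : M) (v w : TangentSpace 𝓘(ℝ, E) x) :
    g.inChart x x v w = g.val x v w := by
  change g.val x ((trivializationAt E (TangentSpace 𝓘(ℝ, E)) x).symmL ℝ x v)
    ((trivializationAt E (TangentSpace 𝓘(ℝ, E)) x).symmL ℝ x w) = _
  rw [symmL_self, symmL_self]

/-- A Lorentzian metric is nondegenerate. -/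
lemma nondegenerate (g : LorentzMetric E M) (x : M) (v : TangentSpace 𝓘(ℝ, E) x)
    (h : ∀ w, g.val x v w = 0) : v = 0 := by
  obtain ⟨t, ht, hp⟩ := g.signature x
  by_contra hv
  exact absurd (hp v hv (by rw [g.symm]; exact h t)) (by simp [h v])


/-- The components of the metric form an invertible matrix. -/
lemma isInvertible_inChart [FiniteDimensional ℝ E] (g : LorentzMetric E M) (x : M) :
    (g.inChart x x).IsInvertible := by
  have hinj : Function.Injective (g.inChart x x : E →ₗ[ℝ] (E →L[ℝ] ℝ)) := by
    rw [← LinearMap.ker_eq_bot, LinearMap.ker_eq_bot']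
    intro v hv
    refine g.nondegenerate x v fun w ↦ ?_
    exact (g.inChart_self x v w).symm.trans congr($hv w)
  have hd : finrank ℝ E = finrank ℝ (E →L[ℝ] ℝ) := by
    rw [← LinearMap.toContinuousLinearMap.finrank_eq (M := E →ₗ[ℝ] ℝ)]
    exact (Subspace.dual_finrank_eq (K := ℝ) (V := E)).symm
  refine ⟨(LinearEquiv.ofInjectiveOfFinrankEq _ hinj hd).toContinuousLinearEquiv, ?_⟩
  ext v w
  rfl

/-- The defining property of the Christoffel symbols. -/
lemma val_christoffel [FiniteDimensional ℝ E] (g : LorentzMetric E M) (x : M) (u v w : E) :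
    g.inChart x x (g.christoffel x v u) w =
      (g.dInChart x u v w + g.dInChart x v u w - g.dInChart x w v u) / 2 := by
  have := (g.isInvertible_inChart x)
  obtain ⟨e, he⟩ := this
  have h2 : g.inChart x x (g.christoffel x v u) = (1 / 2 : ℝ) • g.christoffelFirst x v u := by
    simp [christoffel, ← he]
  rw [h2]
  simp [christoffelFirst]
  ring

lemma mdifferentiableAt_inChart (g : LorentzMetric E M) (x : M) :
    MDifferentiableAt 𝓘(ℝ, E) 𝓘(ℝ, E →L[ℝ] E →L[ℝ] ℝ) (g.inChart x) x := by
  have h := (g.contMDiff x).mdifferentiableAt (by simp)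
  have h2 := (mdifferentiableAt_section _ _).1 h
  refine h2.congr_of_eventuallyEq ?_
  have hb : (trivializationAt E (TangentSpace 𝓘(ℝ, E)) x).baseSet ∈ 𝓝 x :=
    (trivializationAt E (TangentSpace 𝓘(ℝ, E)) x).open_baseSet.mem_nhds
      (mem_baseSet_trivializationAt' x)
  filter_upwards [hb] with y hy
  ext v w
  rw [hom_trivializationAt_apply]
  refine Eq.symm ((inCoordinates_apply_eq₂ (E₃ := Bundle.Trivial M ℝ) (F₃ := ℝ) hy hy (mem_univ _)).trans ?_)
  refine Eq.trans (b := g.val y ((trivializationAt E (TangentSpace 𝓘(ℝ, E)) x).symm y v)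
    ((trivializationAt E (TangentSpace 𝓘(ℝ, E)) x).symm y w))
    (congr($(Trivial.linearMapAt_trivialization (𝕜 := ℝ) (B := M) (F := ℝ) y) _)) ?_
  rw [← Trivialization.symmL_apply (R := ℝ) _ hy, ← Trivialization.symmL_apply (R := ℝ) _ hy]
  rfl

lemma _root_.mdifferentiableAt_tangentCoord {x : M} {σ : Π y : M, TangentSpace 𝓘(ℝ, E) y}
    (h : MDiffAt (T% σ) x) :
    MDifferentiableAt 𝓘(ℝ, E) 𝓘(ℝ, E) (fun y ↦ tangentCoord x ⟨y, σ y⟩) x :=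
  (mdifferentiableAt_section _ _).1 h

lemma _root_.tangentCoord_add {x y : M}
    (hy : y ∈ (trivializationAt E (TangentSpace 𝓘(ℝ, E)) x).baseSet)
    (v w : TangentSpace 𝓘(ℝ, E) y) :
    tangentCoord x ⟨y, v + w⟩ = tangentCoord x ⟨y, v⟩ + tangentCoord x ⟨y, w⟩ :=
  ((trivializationAt E (TangentSpace 𝓘(ℝ, E)) x).linear ℝ hy).map_add v w

lemma _root_.tangentCoord_smul {x y : M}
    (hy : y ∈ (trivializationAt E (TangentSpace 𝓘(ℝ, E)) x).baseSet)
    (c : ℝ) (v : TangentSpace 𝓘(ℝ, E) y) :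
    tangentCoord x ⟨y, c • v⟩ = c • tangentCoord x ⟨y, v⟩ :=
  ((trivializationAt E (TangentSpace 𝓘(ℝ, E)) x).linear ℝ hy).map_smul c v

lemma _root_.eventually_mem_baseSet (x : M) :
    ∀ᶠ y in 𝓝 x, y ∈ (trivializationAt E (TangentSpace 𝓘(ℝ, E)) x).baseSet :=
  (trivializationAt E (TangentSpace 𝓘(ℝ, E)) x).open_baseSet.mem_nhds
      (mem_baseSet_trivializationAt' x)

/-- `∇σ` at `x`, computed in the chart at `x`: `(∇_u σ)^k = ∂_u σ^k + Γ^k(u, σ)`. -/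
def covDeriv (g : LorentzMetric E M) (σ : Π x : M, TangentSpace 𝓘(ℝ, E) x) (x : M) :
    TangentSpace 𝓘(ℝ, E) x →L[ℝ] TangentSpace 𝓘(ℝ, E) x :=
  letI d : E →L[ℝ] E := mvfderiv 𝓘(ℝ, E) (fun y ↦ tangentCoord x ⟨y, σ y⟩) x
  d + g.christoffel x (σ x)

lemma christoffelFirst_apply (g : LorentzMetric E M) (x : M) (v u w : E) :
    g.christoffelFirst x v u w = g.dInChart x u v w + g.dInChart x v u w - g.dInChart x w v u :=
  rfl

lemma christoffelFirst_add (g : LorentzMetric E M) (x : M) (v w : E) :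
    g.christoffelFirst x (v + w) = g.christoffelFirst x v + g.christoffelFirst x w := by
  refine ContinuousLinearMap.ext fun a ↦ ContinuousLinearMap.ext fun b ↦ ?_
  change g.dInChart x a (v + w) b + g.dInChart x (v + w) a b - g.dInChart x b (v + w) a =
    (g.dInChart x a v b + g.dInChart x v a b - g.dInChart x b v a) +
    (g.dInChart x a w b + g.dInChart x w a b - g.dInChart x b w a)
  have h1 (a b) : g.dInChart x a (v + w) b = g.dInChart x a v b + g.dInChart x a w b :=
    congr($(map_add (g.dInChart x a) v w) b)
  have h2 : g.dInChart x (v + w) a b = g.dInChart x v a b + g.dInChart x w a b :=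
    congr($((g.dInChart x).map_add v w) a b)
  rw [h1, h1, h2]
  ring

lemma christoffelFirst_smul (g : LorentzMetric E M) (x : M) (c : ℝ) (v : E) :
    g.christoffelFirst x (c • v) = c • g.christoffelFirst x v := by
  refine ContinuousLinearMap.ext fun a ↦ ContinuousLinearMap.ext fun b ↦ ?_
  change g.dInChart x a (c • v) b + g.dInChart x (c • v) a b - g.dInChart x b (c • v) a =
    c * (g.dInChart x a v b + g.dInChart x v a b - g.dInChart x b v a)
  have h1 (a b) : g.dInChart x a (c • v) b = c * g.dInChart x a v b :=
    congr($(map_smul (g.dInChart x a) c v) b)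
  have h2 : g.dInChart x (c • v) a b = c * g.dInChart x v a b :=
    congr($((g.dInChart x).map_smul c v) a b)
  rw [h1, h1, h2]
  ring

lemma christoffel_add (g : LorentzMetric E M) (x : M) (v w : E) :
    g.christoffel x (v + w) = g.christoffel x v + g.christoffel x w := by
  simp only [christoffel, christoffelFirst_add, ContinuousLinearMap.comp_add, smul_add]

lemma christoffel_smul (g : LorentzMetric E M) (x : M) (c : ℝ) (v : E) :
    g.christoffel x (c • v) = c • g.christoffel x v := by
  ext u
  simp only [christoffel, christoffelFirst_smul, smul_apply,
    ContinuousLinearMap.comp_apply, map_smul]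
  module

lemma _root_.mvfderiv_congr {F : Type*} [NormedAddCommGroup F] [NormedSpace ℝ F] {x : M}
    {a b : M → F} (h : a =ᶠ[𝓝 x] b) :
    mvfderiv 𝓘(ℝ, E) a x = mvfderiv 𝓘(ℝ, E) b x := by
  ext u
  exact congr($(h.mfderiv_eq (I := 𝓘(ℝ, E)) (I' := 𝓘(ℝ, F))) u)

lemma covDeriv_apply (g : LorentzMetric E M) (σ : Π x : M, TangentSpace 𝓘(ℝ, E) x) (x : M)
    (u : TangentSpace 𝓘(ℝ, E) x) :
    (g.covDeriv σ x u : E) =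
      mvfderiv 𝓘(ℝ, E) (fun y ↦ tangentCoord x ⟨y, σ y⟩) x u + g.christoffel x (σ x) u :=
  rfl

/-- The Levi-Civita connection of `g`. -/
def leviCivita (g : LorentzMetric E M) :
    CovariantDerivative 𝓘(ℝ, E) E (TangentSpace 𝓘(ℝ, E) : M → Type _) where
  toFun := g.covDeriv
  isCovariantDerivativeOnUniv :=
    { add := by
        intro σ σ' x hσ hσ' _
        have h : (fun y ↦ tangentCoord x ⟨y, (σ + σ') y⟩) =ᶠ[𝓝 x]
            (fun y ↦ tangentCoord x ⟨y, σ y⟩) + fun y ↦ tangentCoord x ⟨y, σ' y⟩ := by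
          filter_upwards [eventually_mem_baseSet (E := E) x] with y hy
          exact tangentCoord_add hy _ _
        have h1 := (mvfderiv_congr h).trans
          (mvfderiv_add (mdifferentiableAt_tangentCoord hσ) (mdifferentiableAt_tangentCoord hσ'))
        have h2 := g.christoffel_add x (σ x) (σ' x)
        ext u
        exact (congr($h1 u + $h2 u)).trans (add_add_add_comm (G := E) _ _ _ _)
      leibniz := by
        intro σ c x hσ hc _
        have h : (fun y ↦ tangentCoord x ⟨y, (c • σ) y⟩) =ᶠ[𝓝 x]
            c • (fun y ↦ tangentCoord x ⟨y, σ y⟩) := by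
          filter_upwards [eventually_mem_baseSet (E := E) x] with y hy
          exact tangentCoord_smul hy _ _
        have h1 := (mvfderiv_congr h).trans
          (mvfderiv_smul hc (mdifferentiableAt_tangentCoord hσ))
        rw [tangentCoord_self] at h1
        have h2 := g.christoffel_smul x (c x) (σ x)
        ext u
        refine (congr($h1 u + $h2 u)).trans ?_
        refine (add_right_comm (G := E) _ _ _).trans ?_
        exact congr($((smul_add (A := E) (c x) _ _).symm) + _) }

lemma leviCivita_apply (g : LorentzMetric E M) (σ : Π x : M, TangentSpace 𝓘(ℝ, E) x) (x : M)
    (u : TangentSpace 𝓘(ℝ, E) x) :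
    (g.leviCivita σ x u : E) =
      mvfderiv 𝓘(ℝ, E) (fun y ↦ tangentCoord x ⟨y, σ y⟩) x u + g.christoffel x (σ x) u :=
  rfl

lemma _root_.tangentCoord_extend {x y : M}
    (hy : y ∈ (trivializationAt E (TangentSpace 𝓘(ℝ, E)) x).baseSet)
    (v : TangentSpace 𝓘(ℝ, E) x) :
    tangentCoord x ⟨y, extend E v y⟩ = v := by
  have h := congr(($((trivializationAt E (TangentSpace 𝓘(ℝ, E)) x).apply_mk_symm hy
    (tangentCoord x ⟨x, v⟩))).2)
  exact h.trans (tangentCoord_self x v)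

lemma _root_.MDifferentiableAt.hasFDerivAt_chart {F : Type*} [NormedAddCommGroup F]
    [NormedSpace ℝ F] {f : M → F} {x : M} (hf : MDifferentiableAt 𝓘(ℝ, E) 𝓘(ℝ, F) f x) :
    HasFDerivAt (f ∘ (extChartAt 𝓘(ℝ, E) x).symm) (mvfderiv 𝓘(ℝ, E) f x : E →L[ℝ] F)
      (extChartAt 𝓘(ℝ, E) x x) := by
  have h := hf.hasMFDerivAt.2
  rw [ModelWithCorners.range_eq_univ] at h
  exact hasFDerivWithinAt_univ.1 h

lemma hasFDerivAt_inChart (g : LorentzMetric E M) (x : M) (v w : E) :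
    HasFDerivAt (fun z ↦ g.inChart x ((extChartAt 𝓘(ℝ, E) x).symm z) v w)
      (((g.dInChart x).flip v).flip w) (extChartAt 𝓘(ℝ, E) x x) := by
  have h := ((g.mdifferentiableAt_inChart x).hasFDerivAt_chart.clm_apply
    (hasFDerivAt_const v _)).clm_apply (hasFDerivAt_const w _)
  convert! h using 1
  ext u
  simp [dInChart]

lemma dInChart_symm (g : LorentzMetric E M) (x : M) (u v w : E) :
    g.dInChart x u v w = g.dInChart x u w v := by
  have h1 := g.hasFDerivAt_inChart x v w
  have h2 := g.hasFDerivAt_inChart x w v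
  have h3 : (fun z ↦ g.inChart x ((extChartAt 𝓘(ℝ, E) x).symm z) v w) =
      fun z ↦ g.inChart x ((extChartAt 𝓘(ℝ, E) x).symm z) w v := by
    funext z
    exact g.symm _ _ _
  rw [h3] at h1
  exact congr($(h1.unique h2) u)

lemma christoffel_symm (g : LorentzMetric E M) (x : M) (v u : E) :
    g.christoffel x v u = g.christoffel x u v := by
  have : g.christoffelFirst x v u = g.christoffelFirst x u v := by
    refine ContinuousLinearMap.ext fun w ↦ ?_
    rw [christoffelFirst_apply, christoffelFirst_apply, g.dInChart_symm x w u v]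
    ring
  simp [christoffel, this]

lemma mlieBracket_extend (x : M) (u v : TangentSpace 𝓘(ℝ, E) x) :
    VectorField.mlieBracket 𝓘(ℝ, E) (extend E u) (extend E v) x = 0 := by
  have key (u : TangentSpace 𝓘(ℝ, E) x) : VectorField.mpullbackWithin 𝓘(ℝ, E) 𝓘(ℝ, E)
      (extChartAt 𝓘(ℝ, E) x).symm (extend E u) (range 𝓘(ℝ, E)) =ᶠ[𝓝 (extChartAt 𝓘(ℝ, E) x x)]
      fun _ ↦ u := by
    filter_upwards [extChartAt_target_mem_nhds (I := 𝓘(ℝ, E)) x] with z hz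
    have hy : (extChartAt 𝓘(ℝ, E) x).symm z ∈ (chartAt E x).source := by
      have := (extChartAt 𝓘(ℝ, E) x).map_target hz
      rwa [extChartAt_source] at this
    have h1 : extend E u ((extChartAt 𝓘(ℝ, E) x).symm z) =
        mfderivWithin 𝓘(ℝ, E) 𝓘(ℝ, E) (extChartAt 𝓘(ℝ, E) x).symm (range 𝓘(ℝ, E)) z u := by
      have h2 := TangentBundle.symmL_trivializationAt (I := 𝓘(ℝ, E)) hy
      rw [(extChartAt 𝓘(ℝ, E) x).right_inv hz] at h2
      rw [← h2]
      refine Eq.trans ?_ (Trivialization.symmL_apply (R := ℝ) (F := E)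
        (trivializationAt E (TangentSpace 𝓘(ℝ, E)) x) (by simpa using hy) u).symm
      exact congr((trivializationAt E (TangentSpace 𝓘(ℝ, E)) x).symm _ $(tangentCoord_self x u))
    rw [VectorField.mpullbackWithin_apply, h1]
    exact (isInvertible_mfderivWithin_extChartAt_symm hz).inverse_apply_eq.2 rfl
  rw [← VectorField.mlieBracketWithin_univ, VectorField.mlieBracketWithin_apply,
    Filter.EventuallyEq.lieBracketWithin_vectorField_eq_nhds (key u) (key v)]
  have h0 (a b : E) (s : Set E) (z : E) :
      VectorField.lieBracketWithin ℝ (fun _ : E ↦ a) (fun _ : E ↦ b) s z = 0 := by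
    simp [VectorField.lieBracketWithin]
  erw [h0 u v]
  exact map_zero _

/-- The Levi-Civita connection is torsion-free. -/
lemma leviCivita_torsion [FiniteDimensional ℝ E] (g : LorentzMetric E M) :
    g.leviCivita.torsion = 0 := by
  ext x u v
  have hΓ := g.christoffel_symm x v u
  have hc (u v : TangentSpace 𝓘(ℝ, E) x) :
      g.leviCivita (extend E v) x u = g.christoffel x v u := by
    have h : (fun y ↦ tangentCoord x ⟨y, extend E v y⟩) =ᶠ[𝓝 x] fun _ ↦ (v : E) := by
      filter_upwards [eventually_mem_baseSet (E := E) x] with y hy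
      exact tangentCoord_extend hy v
    have h' := (mvfderiv_congr h).trans (mvfderiv_const (I := 𝓘(ℝ, E)) (F := E) v)
    rw [leviCivita_apply, h', extend_apply_self]
    exact zero_add (M := E) _
  rw [CovariantDerivative.torsion_apply_eq_extend, mlieBracket_extend, extend_apply_self,
    extend_apply_self, hc, hc]
  exact (sub_zero _).trans (sub_eq_zero.2 hΓ)

set_option synthInstance.maxHeartbeats 200000 in
lemma _root_.mvfderiv_bilin {x : M} {A : M → E →L[ℝ] E →L[ℝ] ℝ} {s t : M → E}
    (hA : MDifferentiableAt 𝓘(ℝ, E) 𝓘(ℝ, E →L[ℝ] E →L[ℝ] ℝ) A x)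
    (hs : MDifferentiableAt 𝓘(ℝ, E) 𝓘(ℝ, E) s x) (ht : MDifferentiableAt 𝓘(ℝ, E) 𝓘(ℝ, E) t x)
    (u : TangentSpace 𝓘(ℝ, E) x) :
    mvfderiv 𝓘(ℝ, E) (fun y ↦ A y (s y) (t y)) x u =
      A x (s x) (mvfderiv 𝓘(ℝ, E) t x u) + (A x (mvfderiv 𝓘(ℝ, E) s x u) (t x)
        + mvfderiv 𝓘(ℝ, E) A x u (s x) (t x)) := by
  have aux {A' : E → E →L[ℝ] E →L[ℝ] ℝ} {s' t' : E → E} {dA : E →L[ℝ] E →L[ℝ] E →L[ℝ] ℝ}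
      {ds dt : E →L[ℝ] E} {z : E} {d : E →L[ℝ] ℝ} (hA : HasFDerivAt A' dA z)
      (hs : HasFDerivAt s' ds z) (ht : HasFDerivAt t' dt z)
      (hd : HasFDerivAt (fun z ↦ A' z (s' z) (t' z)) d z) (u : E) :
      d u = A' z (s' z) (dt u) + (A' z (ds u) (t' z) + dA u (s' z) (t' z)) := by
    rw [hd.unique ((hA.clm_apply hs).clm_apply ht)]
    rfl
  have := aux hA.hasFDerivAt_chart hs.hasFDerivAt_chart ht.hasFDerivAt_chart
    ((hA.clm_apply hs).clm_apply ht).hasFDerivAt_chart u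
  simp only [Function.comp_apply, extChartAt_to_inv] at this
  exact this

/-- The Levi-Civita connection is compatible with the metric. -/
lemma leviCivita_metric [FiniteDimensional ℝ E] (g : LorentzMetric E M)
    {σ τ : Π x : M, TangentSpace 𝓘(ℝ, E) x} {x : M} (hσ : MDiffAt (T% σ) x)
    (hτ : MDiffAt (T% τ) x) (u : TangentSpace 𝓘(ℝ, E) x) :
    mvfderiv 𝓘(ℝ, E) (fun y ↦ g.val y (σ y) (τ y)) x u =
      g.val x (g.leviCivita σ x u) (τ x) + g.val x (σ x) (g.leviCivita τ x u) := by
  have hs := mdifferentiableAt_tangentCoord hσ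
  have ht := mdifferentiableAt_tangentCoord hτ
  have hg := g.mdifferentiableAt_inChart x
  have heq : (fun y ↦ g.val y (σ y) (τ y)) =ᶠ[𝓝 x]
      fun y ↦ g.inChart x y (tangentCoord x ⟨y, σ y⟩) (tangentCoord x ⟨y, τ y⟩) := by
    filter_upwards [eventually_mem_baseSet (E := E) x] with y hy
    have hc (v : TangentSpace 𝓘(ℝ, E) y) :
        (trivializationAt E (TangentSpace 𝓘(ℝ, E)) x).symmL ℝ y (tangentCoord x ⟨y, v⟩) = v :=
      (Trivialization.symmL_apply (R := ℝ) (F := E) _ hy _).trans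
        ((trivializationAt E (TangentSpace 𝓘(ℝ, E)) x).symm_apply_apply_mk hy v)
    exact congr(g.val y $((hc (σ y)).symm) $((hc (τ y)).symm))
  have h1 := congr($(mvfderiv_congr heq) u).trans (mvfderiv_bilin hg hs ht u)
  rw [tangentCoord_self, tangentCoord_self] at h1
  have key (a b s t w : E) : g.inChart x x s b + (g.inChart x x a t + g.dInChart x w s t) =
      g.inChart x x (a + g.christoffel x s w) t + g.inChart x x s (b + g.christoffel x t w) := by
    have hsy : g.inChart x x s (g.christoffel x t w) = g.inChart x x (g.christoffel x t w) s :=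
      g.symm _ _ _
    have e1 : g.inChart x x (a + g.christoffel x s w) t =
        g.inChart x x a t + g.inChart x x (g.christoffel x s w) t :=
      congr($((g.inChart x x).map_add a _) t)
    have e2 : g.inChart x x s (b + g.christoffel x t w) =
        g.inChart x x s b + g.inChart x x s (g.christoffel x t w) :=
      (g.inChart x x s).map_add b _
    rw [e1, e2, hsy, val_christoffel, val_christoffel, g.dInChart_symm x w s t, g.dInChart_symm x s t w,
      g.dInChart_symm x t s w]
    ring
  have hk := key (mvfderiv 𝓘(ℝ, E) (fun y ↦ tangentCoord x ⟨y, σ y⟩) x u)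
    (mvfderiv 𝓘(ℝ, E) (fun y ↦ tangentCoord x ⟨y, τ y⟩) x u) (σ x) (τ x) u
  refine (h1.trans hk).trans ?_
  exact congr($(g.inChart_self x (g.leviCivita σ x u) (τ x)) +
    $(g.inChart_self x (σ x) (g.leviCivita τ x u)))
end LorentzMetric

section Curvature

variable {E : Type*} [NormedAddCommGroup E] [NormedSpace ℝ E]
  {M : Type*} [TopologicalSpace M] [ChartedSpace E M] [IsManifold 𝓘(ℝ, E) ∞ M]

/-- The curvature operator `R(X, Y)Z = ∇_X ∇_Y Z - ∇_Y ∇_X Z - ∇_[X, Y] Z` of an affine connection,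
on vector fields. -/
def curvatureOfFields (cov : CovariantDerivative 𝓘(ℝ, E) E (TangentSpace 𝓘(ℝ, E) : M → Type _))
    (X Y Z : Π x : M, TangentSpace 𝓘(ℝ, E) x) (x : M) : TangentSpace 𝓘(ℝ, E) x :=
  cov (fun y ↦ cov Z y (Y y)) x (X x) - cov (fun y ↦ cov Z y (X y)) x (Y x)
    - cov Z x (VectorField.mlieBracket 𝓘(ℝ, E) X Y x)

/-- The curvature tensor `R(u, v)w` of an affine connection at `x`: the curvature operator on
vector fields that extend `u`, `v`, `w` (here, those with constant components in the chart
at `x`). -/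
def curvatureTensor (cov : CovariantDerivative 𝓘(ℝ, E) E (TangentSpace 𝓘(ℝ, E) : M → Type _))
    (x : M) (u v w : TangentSpace 𝓘(ℝ, E) x) : TangentSpace 𝓘(ℝ, E) x :=
  curvatureOfFields cov (extend E u) (extend E v) (extend E w) x

/-- The isotropic sectional curvature `K_N(σ) = (R(P, N)N, P) / (P, P)` of the isotropic plane `σ`
spanned by the isotropic vector `N` and the nonisotropic vector `P`. -/
def isotropicSectionalCurvature (g : LorentzMetric E M) (x : M)
    (N P : TangentSpace 𝓘(ℝ, E) x) : ℝ :=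
  g.val x (curvatureTensor g.leviCivita x P N N) P / g.val x P P

end Curvature

section Hypersurface

variable {E : Type*} [NormedAddCommGroup E] [NormedSpace ℝ E]
  {M : Type*} [TopologicalSpace M] [ChartedSpace E M] [IsManifold 𝓘(ℝ, E) ∞ M]
  {E' : Type*} [NormedAddCommGroup E'] [NormedSpace ℝ E']
  {V : Type*} [TopologicalSpace V] [ChartedSpace E' V]

/-- The Levi-Civita covariant derivative of a vector field `W` along a map `f : V → M`,
computed in the chart of `M` at `f q`: `(D_u W)^k = ∂_u W^k + Γ^k(f_* u, W)`. -/
def covDerivAlong (g : LorentzMetric E M) (f : V → M) (W : Π q : V, TangentSpace 𝓘(ℝ, E) (f q))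
    (q : V) (u : TangentSpace 𝓘(ℝ, E') q) : TangentSpace 𝓘(ℝ, E) (f q) :=
  letI a : E := mvfderiv 𝓘(ℝ, E') (fun q' ↦ tangentCoord (f q) ⟨f q', W q'⟩) q u
  letI b : E := g.christoffel (f q) (W q) (mfderiv 𝓘(ℝ, E') 𝓘(ℝ, E) f q u)
  a + b

/-- The image `f_* Y` of a vector field `Y` on `V`, a vector field along `f`. -/
def pushField (f : V → M) (Y : Π q : V, TangentSpace 𝓘(ℝ, E') q) (q : V) :
    TangentSpace 𝓘(ℝ, E) (f q) :=
  mfderiv 𝓘(ℝ, E') 𝓘(ℝ, E) f q (Y q)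

/-- The velocity of a curve. -/
def velocity (γ : ℝ → M) (t : ℝ) : TangentSpace 𝓘(ℝ, E) (γ t) :=
  mfderiv 𝓘(ℝ, ℝ) 𝓘(ℝ, E) γ t (1 : ℝ)

/-- The curve `γ` is a (possibly constant, affinely parametrized) geodesic of `(M, g)` on the
open set `s` of parameters. -/
def IsGeodesicOn (g : LorentzMetric E M) (γ : ℝ → M) (s : Set ℝ) : Prop :=
  ContMDiffOn 𝓘(ℝ, ℝ) 𝓘(ℝ, E) 2 γ s ∧
    ∀ t ∈ s, covDerivAlong (E' := ℝ) g γ (velocity γ) t (1 : ℝ) = 0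

/-- `f : V → M` is a lightlike hypersurface of `(M, g)`: a smooth immersion of codimension one
such that every tangent hyperplane `f_* T_p V` is isotropic, i.e. `g` is degenerate on it. -/
structure IsLightlikeHypersurface (g : LorentzMetric E M) (f : V → M) : Prop where
  dim : finrank ℝ E' + 1 = finrank ℝ E
  contMDiff : ContMDiff 𝓘(ℝ, E') 𝓘(ℝ, E) ∞ f
  immersion (p : V) : Function.Injective (mfderiv 𝓘(ℝ, E') 𝓘(ℝ, E) f p)
  degenerate (p : V) : ∃ ξ : TangentSpace 𝓘(ℝ, E') p, ξ ≠ 0 ∧ ∀ x : TangentSpace 𝓘(ℝ, E') p,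
    g.val (f p) (mfderiv 𝓘(ℝ, E') 𝓘(ℝ, E) f p ξ) (mfderiv 𝓘(ℝ, E') 𝓘(ℝ, E) f p x) = 0

/-- The hypersurface `f : V → M` is totally geodesic: for each vector `v` tangent to `V`, the
geodesic of `(M, g)` with initial velocity `v` runs in `V` for a short time, i.e. it is the image
of a curve `c` in `V`. -/
def IsTotallyGeodesic (g : LorentzMetric E M) (f : V → M) : Prop :=
  ∀ v : TangentBundle 𝓘(ℝ, E') V, ∃ ε > 0, ∃ c : ℝ → V,
    ContMDiffOn 𝓘(ℝ, ℝ) 𝓘(ℝ, E') 2 c (Ioo (-ε) ε) ∧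
    (⟨c 0, velocity c 0⟩ : TangentBundle 𝓘(ℝ, E') V) = v ∧
    IsGeodesicOn g (f ∘ c) (Ioo (-ε) ε)

/-- The second fundamental tensor of a lightlike hypersurface at `p`, relative to an isotropic
vector `ξ` tangent to `V`: minus the scalar product of `∇_x (f_* Y)` with `f_* ξ`. For an isotropic
frame with `e₁ = f_* ξ` and `(e₁, eₙ) = -1` this is the component of `∇_x (f_* Y)` along `eₙ`.
It depends on the vector field `Y` only through `Y p`. -/
def secondFundamentalTensor (g : LorentzMetric E M) (f : V → M) (p : V)
    (ξ x : TangentSpace 𝓘(ℝ, E') p) (Y : Π q : V, TangentSpace 𝓘(ℝ, E') q) : ℝ :=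
  - g.val (f p) (covDerivAlong g f (pushField f Y) p x) (mfderiv 𝓘(ℝ, E') 𝓘(ℝ, E) f p ξ)

/-- An isotropic normalization of a hypersurface: a smooth field of isotropic straight lines
along `f` that are not tangent to the hypersurface. -/
structure IsotropicNormalization (g : LorentzMetric E M) (f : V → M) where
  /-- the normalizing straight line at each point -/
  line (p : V) : Submodule ℝ (TangentSpace 𝓘(ℝ, E) (f p))
  exists_section (p : V) : ∃ U ∈ 𝓝 p, ∃ N : Π q : V, TangentSpace 𝓘(ℝ, E) (f q),
    ContMDiffOn 𝓘(ℝ, E') 𝓘(ℝ, E).tangent ∞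
      (fun q ↦ (⟨f q, N q⟩ : TangentBundle 𝓘(ℝ, E) M)) U ∧
    ∀ q ∈ U, line q = Submodule.span ℝ {N q} ∧ g.val (f q) (N q) (N q) = 0 ∧
      ∀ x : TangentSpace 𝓘(ℝ, E') q, mfderiv 𝓘(ℝ, E') 𝓘(ℝ, E) f q x ≠ N q

/-- The affine connection `cov` on `V` is induced by the isotropic normalization `N`:
`f_* (cov_x Y)` is the projection of `∇_x (f_* Y)` to the tangent hyperplane of `V` along the
normalizing line. -/
def IsInducedConnection [IsManifold 𝓘(ℝ, E') ∞ V] (g : LorentzMetric E M) (f : V → M)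
    (N : IsotropicNormalization (E' := E') g f)
    (cov : CovariantDerivative 𝓘(ℝ, E') E' (TangentSpace 𝓘(ℝ, E') : V → Type _)) : Prop :=
  ∀ (p : V) (x : TangentSpace 𝓘(ℝ, E') p) (Y : Π q : V, TangentSpace 𝓘(ℝ, E') q),
    MDiffAt (T% Y) p →
      covDerivAlong g f (pushField f Y) p x - mfderiv 𝓘(ℝ, E') 𝓘(ℝ, E) f p (cov Y p x) ∈ N.line p

end Hypersurface

end

/-! Everything rests on one fact: for a totally geodesic immersion, the ambient covariant derivative
of a tangent field in a tangent direction is again tangent. In charts let `φ` be the local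
expression of `f` and `Γ` the Christoffel symbols. Writing a geodesic as `φ ∘ c`, the geodesic
equation reads `D²φ(v, v) + Γ(Dφ v, Dφ v) = -Dφ(c'')`, so the left side lies in the range of `Dφ`
for each initial velocity `v`. Both `D²φ` and `Γ` are symmetric, so polarization extends this to
`D²φ(u, v) + Γ(Dφ v, Dφ u)` (`christoffel_mem_range_of_isTotallyGeodesic'`), and the Leibniz rule
extends it to arbitrary differentiable tangent fields (`exists_mfderiv_eq_covDerivAlong`).

Hence the Levi-Civita connection restricts to a connection on `V` without any projection
(`exists_covariantDerivative_of_isTotallyGeodesic`). It is induced by every normalization at once,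
and transversality of the normalizing lines gives uniqueness. Its curvature is the ambient one:
covariant derivatives along `φ` in two constant directions commute up to the ambient curvature
(`christoffelDeriv_comm`).

For the scalar products, Lorentzian signature makes orthogonal isotropic vectors proportional. Every
isotropic tangent vector is therefore a multiple of the degenerate direction and orthogonal to all
of `T_pV` (`IsLightlikeHypersurface.val_eq_zero_of_isotropic`). Tangency of `∇_x Y` then kills the
second fundamental tensor. For the sectional curvature, skewness of the curvature operator turns
`g(R(P, N)N, P)` into `-g(N, R(P, N)P)`, where `R(P, N)P` is tangent because it is the image of the
intrinsic curvature.

Since the connections are defined at each point in the chart centred there, while curvature needs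
two derivatives, much of the work consists in rewriting them in one fixed chart. -/

noncomputable section

set_option maxSynthPendingDepth 3

/-! ### Functions, vectors and vector fields in a fixed chart -/

section Charts

variable {E : Type*} [NormedAddCommGroup E] [NormedSpace ℝ E]
  {M : Type*} [TopologicalSpace M] [ChartedSpace E M] [IsManifold 𝓘(ℝ, E) ∞ M]
  {E' : Type*} [NormedAddCommGroup E'] [NormedSpace ℝ E']
  {V : Type*} [TopologicalSpace V] [ChartedSpace E' V] [IsManifold 𝓘(ℝ, E') ∞ V]
  {F : Type*} [NormedAddCommGroup F] [NormedSpace ℝ F]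

/-- Identifies the bundle coordinates with the differential of the chart, so that the chain rule
applies to them. -/
lemma tangentCoord_eq_mfderiv {x y : M} (hy : y ∈ (chartAt E x).source)
    (v : TangentSpace 𝓘(ℝ, E) y) :
    tangentCoord x ⟨y, v⟩ = mfderiv 𝓘(ℝ, E) 𝓘(ℝ, E) (extChartAt 𝓘(ℝ, E) x) y v := by
  rw [← TangentBundle.continuousLinearMapAt_trivializationAt hy]
  exact (congrFun (Trivialization.coe_linearMapAt_of_mem (R := ℝ)
    (trivializationAt E (TangentSpace 𝓘(ℝ, E)) x)
      (by rwa [TangentBundle.trivializationAt_baseSet])) v).symm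

lemma eventually_mem_chartAt_source (x : M) : ∀ᶠ y in 𝓝 x, y ∈ (chartAt E x).source :=
  (chartAt E x).open_source.mem_nhds (mem_chart_source E x)

lemma mdifferentiableAt_iff_comp_symm {h : M → F} {x y : M} (hy : y ∈ (chartAt E x).source) :
    MDifferentiableAt 𝓘(ℝ, E) 𝓘(ℝ, F) h y ↔
      DifferentiableAt ℝ (h ∘ (extChartAt 𝓘(ℝ, E) x).symm) (extChartAt 𝓘(ℝ, E) x y) := by
  have := mdifferentiableAt_iff_source_of_mem_source (I := 𝓘(ℝ, E)) (I' := 𝓘(ℝ, F)) (f := h) hy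
  rw [this]
  simp [mdifferentiableWithinAt_iff_differentiableWithinAt, differentiableWithinAt_univ]

lemma contMDiffAt_iff_comp_symm {n : ℕ∞} {h : M → F} {x y : M} (hy : y ∈ (chartAt E x).source) :
    ContMDiffAt 𝓘(ℝ, E) 𝓘(ℝ, F) n h y ↔
      ContDiffAt ℝ n (h ∘ (extChartAt 𝓘(ℝ, E) x).symm) (extChartAt 𝓘(ℝ, E) x y) := by
  have : IsManifold 𝓘(ℝ, E) n M := .of_le (n := ∞) (mod_cast le_top)
  rw [contMDiffAt_iff_source_of_mem_source (I := 𝓘(ℝ, E)) (I' := 𝓘(ℝ, F)) (f := h) hy]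
  simp [contMDiffWithinAt_iff_contDiffWithinAt, contDiffWithinAt_univ]

lemma eventuallyEq_comp_extChartAt {α : Type*} (h : M → α) {x y : M}
    (hy : y ∈ (chartAt E x).source) :
    h =ᶠ[𝓝 y] (h ∘ (extChartAt 𝓘(ℝ, E) x).symm) ∘ extChartAt 𝓘(ℝ, E) x := by
  filter_upwards [(chartAt E x).open_source.mem_nhds hy] with y' hy'
  simp only [Function.comp_apply]
  rw [(extChartAt 𝓘(ℝ, E) x).left_inv (by rwa [extChartAt_source])]

lemma eventually_eq_of_eq_comp_symm {α : Type*} {h : M → α} {k : E → α} {x y : M}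
    (hk : k = h ∘ (extChartAt 𝓘(ℝ, E) x).symm) (hy : y ∈ (chartAt E x).source) :
    ∀ᶠ y' in 𝓝 y, h y' = k (extChartAt 𝓘(ℝ, E) x y') := by
  subst hk
  exact eventuallyEq_comp_extChartAt h hy

lemma MDifferentiableAt.exists_eq_comp_extChartAt {h : M → F} {x y : M}
    (hy : y ∈ (chartAt E x).source) (hh : MDifferentiableAt 𝓘(ℝ, E) 𝓘(ℝ, F) h y) :
    ∃ k : E → F, DifferentiableAt ℝ k (extChartAt 𝓘(ℝ, E) x y) ∧
      ∀ᶠ y' in 𝓝 y, h y' = k (extChartAt 𝓘(ℝ, E) x y') :=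
  ⟨h ∘ (extChartAt 𝓘(ℝ, E) x).symm, (mdifferentiableAt_iff_comp_symm hy).1 hh,
    eventuallyEq_comp_extChartAt h hy⟩

lemma mvfderiv_eq_fderiv_comp_symm {h : M → F} {x y : M} (hy : y ∈ (chartAt E x).source)
    (hh : MDifferentiableAt 𝓘(ℝ, E) 𝓘(ℝ, F) h y) (u : TangentSpace 𝓘(ℝ, E) y) :
    mvfderiv 𝓘(ℝ, E) h y u =
      fderiv ℝ (h ∘ (extChartAt 𝓘(ℝ, E) x).symm) (extChartAt 𝓘(ℝ, E) x y)
        (tangentCoord x ⟨y, u⟩) := by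
  have hd := (mdifferentiableAt_iff_comp_symm hy).1 hh
  have h1 := mfderiv_comp (I' := 𝓘(ℝ, E)) (I := 𝓘(ℝ, E)) (I'' := 𝓘(ℝ, F)) y
    hd.mdifferentiableAt (mdifferentiableAt_extChartAt (I := 𝓘(ℝ, E)) hy)
  rw [mvfderiv_congr (eventuallyEq_comp_extChartAt h hy), tangentCoord_eq_mfderiv hy]
  rw [mfderiv_eq_fderiv] at h1
  exact congr($h1 u)

lemma tangentCoord_mfderiv {f : V → M} {p q : V} {x : M} (hq : q ∈ (chartAt E' p).source)
    (hx : f q ∈ (chartAt E x).source) (hf : MDifferentiableAt 𝓘(ℝ, E') 𝓘(ℝ, E) f q)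
    (u : TangentSpace 𝓘(ℝ, E') q) :
    tangentCoord x ⟨f q, mfderiv 𝓘(ℝ, E') 𝓘(ℝ, E) f q u⟩ =
      fderiv ℝ ((extChartAt 𝓘(ℝ, E) x ∘ f) ∘ (extChartAt 𝓘(ℝ, E') p).symm)
        (extChartAt 𝓘(ℝ, E') p q) (tangentCoord p ⟨q, u⟩) := by
  have hφ := mdifferentiableAt_extChartAt (I := 𝓘(ℝ, E)) hx
  have h1 := mfderiv_comp (I := 𝓘(ℝ, E')) (I' := 𝓘(ℝ, E)) (I'' := 𝓘(ℝ, E)) q hφ hf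
  rw [tangentCoord_eq_mfderiv hx, ← mvfderiv_eq_fderiv_comp_symm hq (hφ.comp q hf)]
  exact congr($h1.symm u)

/-- The vector field with constant components `v` in the chart at `x`. -/
def chartField (x : M) (v : E) : Π y : M, TangentSpace 𝓘(ℝ, E) y :=
  letI v' : TangentSpace 𝓘(ℝ, E) x := v
  extend E v'

lemma tangentCoord_chartField {x y : M} (hy : y ∈ (chartAt E x).source) (v : E) :
    tangentCoord x ⟨y, chartField x v y⟩ = v :=
  tangentCoord_extend (by rwa [TangentBundle.trivializationAt_baseSet]) _

lemma tangentCoord_injective {x y : M} (hy : y ∈ (chartAt E x).source)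
    {v w : TangentSpace 𝓘(ℝ, E) y}
    (h : tangentCoord x ⟨y, v⟩ = tangentCoord x ⟨y, w⟩) : v = w := by
  rw [tangentCoord_eq_mfderiv hy, tangentCoord_eq_mfderiv hy] at h
  have hi := isInvertible_mfderiv_extChartAt (I := 𝓘(ℝ, E)) (x := x) (y := y)
    (by rwa [extChartAt_source])
  exact hi.injective h

lemma chartField_tangentCoord {x y : M} (hy : y ∈ (chartAt E x).source)
    (v : TangentSpace 𝓘(ℝ, E) y) : chartField x (tangentCoord x ⟨y, v⟩) y = v :=
  tangentCoord_injective hy (tangentCoord_chartField hy _)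

lemma symmL_eq_chartField {x y : M} (hy : y ∈ (chartAt E x).source) (v : E) :
    (trivializationAt E (TangentSpace 𝓘(ℝ, E)) x).symmL ℝ y v = chartField x v y := by
  have hb : y ∈ (trivializationAt E (TangentSpace 𝓘(ℝ, E)) x).baseSet := by
    rwa [TangentBundle.trivializationAt_baseSet]
  refine tangentCoord_injective hy ?_
  rw [tangentCoord_chartField hy, Trivialization.symmL_apply (R := ℝ) _ hb]
  exact congr(($((trivializationAt E (TangentSpace 𝓘(ℝ, E)) x).apply_mk_symm hb v)).2)

lemma mdiffAt_iff_tangentCoord {x y : M} (hy : y ∈ (chartAt E x).source)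
    {σ : Π y : M, TangentSpace 𝓘(ℝ, E) y} :
    MDiffAt (T% σ) y ↔
      MDifferentiableAt 𝓘(ℝ, E) 𝓘(ℝ, E) (fun y' ↦ tangentCoord x ⟨y', σ y'⟩) y :=
  (trivializationAt E (TangentSpace 𝓘(ℝ, E)) x).mdifferentiableAt_section_iff 𝓘(ℝ, E) σ
    (by rwa [TangentBundle.trivializationAt_baseSet])

lemma mdiffAt_chartField {x y : M} (hy : y ∈ (chartAt E x).source) (v : E) :
    MDiffAt (T% (chartField x v)) y := by
  rw [mdiffAt_iff_tangentCoord hy]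
  refine (mdifferentiableAt_const (c := v)).congr_of_eventuallyEq ?_
  filter_upwards [(chartAt E x).open_source.mem_nhds hy] with y' hy'
  exact tangentCoord_chartField hy' v

/-- These fields are pullbacks under the chart of constant fields, and the bracket is natural under
pullback. It is needed at every point of the chart domain, not only at the centre. -/
lemma mlieBracket_chartField [CompleteSpace E] {x y : M} (hy : y ∈ (chartAt E x).source)
    (u v : E) :
    VectorField.mlieBracket 𝓘(ℝ, E) (chartField x u) (chartField x v) y = 0 := by
  let c (u : E) (z : E) : TangentSpace 𝓘(ℝ, E) z := u
  have key (u : E) : VectorField.mpullback 𝓘(ℝ, E) 𝓘(ℝ, E) (extChartAt 𝓘(ℝ, E) x)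
      (c u) =ᶠ[𝓝 y] chartField x u := by
    filter_upwards [(chartAt E x).open_source.mem_nhds hy] with y' hy'
    rw [VectorField.mpullback_apply]
    have hi := isInvertible_mfderiv_extChartAt (I := 𝓘(ℝ, E)) (x := x) (y := y')
      (by rwa [extChartAt_source])
    refine hi.inverse_apply_eq.2 ?_
    rw [← tangentCoord_eq_mfderiv hy', tangentCoord_chartField hy']
  have hc (u : E) : MDiffAt (T% (c u)) (extChartAt 𝓘(ℝ, E) x y) := by
    rw [mdifferentiableAt_section]
    simpa [c] using mdifferentiableAt_const
  have : IsManifold 𝓘(ℝ, E) (minSmoothness ℝ 2) M := by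
    rw [minSmoothness_of_isRCLikeNormedField]
    infer_instance
  have : IsManifold 𝓘(ℝ, E) (minSmoothness ℝ 2) E := by
    rw [minSmoothness_of_isRCLikeNormedField]
    infer_instance
  rw [← Filter.EventuallyEq.mlieBracket_vectorField_eq (key u) (key v)]
  rw [← VectorField.mpullback_mlieBracket (n := 2) (hc u) (hc v) (contMDiffAt_extChartAt' hy)
    (by simp)]
  have h0 : VectorField.mlieBracket 𝓘(ℝ, E) (c u) (c v) = 0 := by
    rw [← VectorField.mlieBracketWithin_univ, VectorField.mlieBracketWithin_eq_lieBracketWithin]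
    ext z
    simp only [VectorField.lieBracketWithin, c, fderivWithin_univ, fderiv_fun_const, Pi.zero_apply,
      zero_apply, sub_self]
    rfl
  rw [VectorField.mpullback_apply, h0]
  exact map_zero _

end Charts

/-! ### The Levi-Civita connection in a fixed chart -/

namespace LorentzMetric

variable {E : Type*} [NormedAddCommGroup E] [NormedSpace ℝ E]
  {M : Type*} [TopologicalSpace M] [ChartedSpace E M] [IsManifold 𝓘(ℝ, E) ∞ M]

/-- The components of the metric in the chart at `x`, as a function on the model space. -/
def localMetric (g : LorentzMetric E M) (x : M) (z : E) : E →L[ℝ] E →L[ℝ] ℝ :=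
  g.inChart x ((extChartAt 𝓘(ℝ, E) x).symm z)

lemma contMDiffAt_inChart (g : LorentzMetric E M) {x y : M} (hy : y ∈ (chartAt E x).source) :
    ContMDiffAt 𝓘(ℝ, E) 𝓘(ℝ, E →L[ℝ] E →L[ℝ] ℝ) ∞ (g.inChart x) y := by
  have hb : y ∈ (trivializationAt E (TangentSpace 𝓘(ℝ, E)) x).baseSet := by
    rwa [TangentBundle.trivializationAt_baseSet]
  have h2 := ((trivializationAt (E →L[ℝ] E →L[ℝ] ℝ)
    (fun x : M ↦ TangentSpace 𝓘(ℝ, E) x →L[ℝ] TangentSpace 𝓘(ℝ, E) x →L[ℝ] ℝ)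
      x).contMDiffAt_section_iff (by simpa [hom_trivializationAt_baseSet] using hb)).1
        (g.contMDiff y)
  refine h2.congr_of_eventuallyEq ?_
  filter_upwards [(trivializationAt E (TangentSpace 𝓘(ℝ, E)) x).open_baseSet.mem_nhds hb] with y hy
  ext v w
  rw [hom_trivializationAt_apply]
  refine Eq.symm ((inCoordinates_apply_eq₂ (E₃ := Bundle.Trivial M ℝ) (F₃ := ℝ) hy hy
    (mem_univ _)).trans ?_)
  refine Eq.trans (b := g.val y ((trivializationAt E (TangentSpace 𝓘(ℝ, E)) x).symm y v)
    ((trivializationAt E (TangentSpace 𝓘(ℝ, E)) x).symm y w))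
    (congr($(Trivial.linearMapAt_trivialization (𝕜 := ℝ) (B := M) (F := ℝ) y) _)) ?_
  rw [← Trivialization.symmL_apply (R := ℝ) _ hy, ← Trivialization.symmL_apply (R := ℝ) _ hy]
  rfl

lemma contDiffAt_localMetric (g : LorentzMetric E M) {x y : M} (hy : y ∈ (chartAt E x).source) :
    ContDiffAt ℝ ∞ (g.localMetric x) (extChartAt 𝓘(ℝ, E) x y) :=
  (contMDiffAt_iff_comp_symm (n := ⊤) hy).1 (g.contMDiffAt_inChart hy)

lemma differentiableAt_localMetric (g : LorentzMetric E M) {x y : M}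
    (hy : y ∈ (chartAt E x).source) :
    DifferentiableAt ℝ (g.localMetric x) (extChartAt 𝓘(ℝ, E) x y) :=
  (g.contDiffAt_localMetric hy).differentiableAt (by simp)

lemma localMetric_symm (g : LorentzMetric E M) (x : M) (z v w : E) :
    g.localMetric x z v w = g.localMetric x z w v :=
  g.symm ((extChartAt 𝓘(ℝ, E) x).symm z) _ _

lemma inChart_apply (g : LorentzMetric E M) {x y : M} (hy : y ∈ (chartAt E x).source) (v w : E) :
    g.inChart x y v w = g.val y (chartField x v y) (chartField x w y) := by
  exact congr(g.val y $(symmL_eq_chartField hy v) $(symmL_eq_chartField hy w))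

lemma localMetric_extChartAt (g : LorentzMetric E M) {x y : M} (hy : y ∈ (chartAt E x).source)
    (v w : TangentSpace 𝓘(ℝ, E) y) :
    g.localMetric x (extChartAt 𝓘(ℝ, E) x y) (tangentCoord x ⟨y, v⟩) (tangentCoord x ⟨y, w⟩) =
      g.val y v w := by
  rw [localMetric, (extChartAt 𝓘(ℝ, E) x).left_inv (by rwa [extChartAt_source]),
    inChart_apply g hy, chartField_tangentCoord hy, chartField_tangentCoord hy]

/-- The Christoffel symbols of the first kind in the chart at `x`, as a function on the model
space. -/
def localChristoffelFirst (g : LorentzMetric E M) (x : M) (z : E) : E →L[ℝ] E →L[ℝ] E →L[ℝ] ℝ :=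
  letI D := fderiv ℝ (g.localMetric x) z
  (1 / 2 : ℝ) • (D.flip + D - (ContinuousLinearMap.flipₗᵢ ℝ E E ℝ).toContinuousLinearEquiv.toContinuousLinearMap.comp D.flip)

/-- The Christoffel symbols in the chart at `x`, as a function on the model space. -/
def localChristoffel (g : LorentzMetric E M) (x : M) (z : E) : E →L[ℝ] E →L[ℝ] E :=
  (ContinuousLinearMap.compL ℝ E (E →L[ℝ] ℝ) E (g.localMetric x z).inverse).comp
    (g.localChristoffelFirst x z)

lemma localChristoffelFirst_apply (g : LorentzMetric E M) (x : M) (z v u w : E) :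
    g.localChristoffelFirst x z v u w = (fderiv ℝ (g.localMetric x) z u v w +
      fderiv ℝ (g.localMetric x) z v u w - fderiv ℝ (g.localMetric x) z w v u) / 2 := by
  simp [localChristoffelFirst]
  ring

lemma localChristoffel_apply (g : LorentzMetric E M) (x : M) (z v u : E) :
    g.localChristoffel x z v u =
      (g.localMetric x z).inverse (g.localChristoffelFirst x z v u) := rfl

lemma isInvertible_localMetric [FiniteDimensional ℝ E] (g : LorentzMetric E M) {x y : M}
    (hy : y ∈ (chartAt E x).source) :
    (g.localMetric x (extChartAt 𝓘(ℝ, E) x y)).IsInvertible := by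
  have hinj : Function.Injective
      (g.localMetric x (extChartAt 𝓘(ℝ, E) x y) : E →ₗ[ℝ] (E →L[ℝ] ℝ)) := by
    rw [← LinearMap.ker_eq_bot, LinearMap.ker_eq_bot']
    intro v hv
    have h0 : chartField x v y = 0 := by
      refine g.nondegenerate y _ fun w ↦ ?_
      rw [← g.localMetric_extChartAt hy, tangentCoord_chartField hy]
      exact congr($hv _)
    rw [← tangentCoord_chartField hy v, h0, tangentCoord_eq_mfderiv hy]
    exact map_zero _
  have hd : finrank ℝ E = finrank ℝ (E →L[ℝ] ℝ) := by
    rw [← LinearMap.toContinuousLinearMap.finrank_eq (M := E →ₗ[ℝ] ℝ)]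
    exact (Subspace.dual_finrank_eq (K := ℝ) (V := E)).symm
  refine ⟨(LinearEquiv.ofInjectiveOfFinrankEq _ hinj hd).toContinuousLinearEquiv, ?_⟩
  ext v w
  rfl

/-- Inversion of linear maps is smooth near an invertible one, and nondegeneracy makes the metric
matrix invertible throughout the chart domain. -/
lemma contDiffAt_localChristoffel [FiniteDimensional ℝ E] (g : LorentzMetric E M) {x y : M}
    (hy : y ∈ (chartAt E x).source) :
    ContDiffAt ℝ ∞ (g.localChristoffel x) (extChartAt 𝓘(ℝ, E) x y) := by
  have hG := g.contDiffAt_localMetric hy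
  have hD : ContDiffAt ℝ ∞ (fderiv ℝ (g.localMetric x)) (extChartAt 𝓘(ℝ, E) x y) :=
    hG.fderiv_right (by simp)
  obtain ⟨e, he⟩ := g.isInvertible_localMetric hy
  have hi : ContDiffAt ℝ ∞ (fun z ↦ (g.localMetric x z).inverse) (extChartAt 𝓘(ℝ, E) x y) := by
    have := contDiffAt_map_inverse (n := ∞) (𝕜 := ℝ) e
    rw [he] at this
    exact this.comp _ hG
  have hflip : ContDiffAt ℝ ∞ (fun z ↦ (fderiv ℝ (g.localMetric x) z).flip)
      (extChartAt 𝓘(ℝ, E) x y) :=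
    (ContinuousLinearMap.flipₗᵢ ℝ E E (E →L[ℝ] ℝ)).contDiff.contDiffAt.comp _ hD
  have hK : ContDiffAt ℝ ∞ (g.localChristoffelFirst x) (extChartAt 𝓘(ℝ, E) x y) :=
    ((hflip.add hD).sub (contDiffAt_const.clm_comp hflip)).const_smul _
  exact ((ContinuousLinearMap.compL ℝ E (E →L[ℝ] ℝ) E).contDiff.contDiffAt.comp _ hi).clm_comp hK

/-- The defining property of the Christoffel symbols. -/
lemma localMetric_localChristoffel [FiniteDimensional ℝ E] (g : LorentzMetric E M) {x y : M}
    (hy : y ∈ (chartAt E x).source) (v u : E) :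
    g.localMetric x (extChartAt 𝓘(ℝ, E) x y) (g.localChristoffel x (extChartAt 𝓘(ℝ, E) x y) v u) =
      g.localChristoffelFirst x (extChartAt 𝓘(ℝ, E) x y) v u := by
  rw [localChristoffel_apply]
  exact (g.isInvertible_localMetric hy).self_apply_inverse _

lemma fderiv_localMetric_symm (g : LorentzMetric E M) {x : M} {z : E}
    (hz : DifferentiableAt ℝ (g.localMetric x) z) (u v w : E) :
    fderiv ℝ (g.localMetric x) z u v w = fderiv ℝ (g.localMetric x) z u w v := by
  have h (v w : E) : HasFDerivAt (fun z ↦ g.localMetric x z v w)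
      (((fderiv ℝ (g.localMetric x) z).flip v).flip w) z := by
    have := (hz.hasFDerivAt.clm_apply (hasFDerivAt_const v _)).clm_apply (hasFDerivAt_const w _)
    convert! this using 1
    ext u
    simp
  have h1 := h v w
  simp only [g.localMetric_symm x _ v w] at h1
  exact congr($(h1.unique (h w v)) u)

/-- The Levi-Civita connection in a fixed chart. -/
lemma tangentCoord_leviCivita_chartField [FiniteDimensional ℝ E] (g : LorentzMetric E M) {x y : M}
    (hy : y ∈ (chartAt E x).source) (v : E) (u' : TangentSpace 𝓘(ℝ, E) y) :
    tangentCoord x ⟨y, g.leviCivita (chartField x v) y u'⟩ =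
      g.localChristoffel x (extChartAt 𝓘(ℝ, E) x y) v (tangentCoord x ⟨y, u'⟩) := by
  have hz := g.differentiableAt_localMetric hy
  set z := extChartAt 𝓘(ℝ, E) x y with hzdef
  have hLC : CompleteSpace E := FiniteDimensional.complete ℝ E
  -- Metric compatibility applied to fields that are constant in the chart: `∂_u g(v, w)` in terms
  -- of `∇`.
  have hmet (u v w : E) : fderiv ℝ (g.localMetric x) z u v w =
      g.val y (g.leviCivita (chartField x v) y (chartField x u y)) (chartField x w y) +
      g.val y (chartField x v y) (g.leviCivita (chartField x w) y (chartField x u y)) := by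
    rw [← g.leviCivita_metric (mdiffAt_chartField hy v) (mdiffAt_chartField hy w)]
    have heq : (fun y ↦ g.val y (chartField x v y) (chartField x w y)) =ᶠ[𝓝 y]
        fun y ↦ g.localMetric x (extChartAt 𝓘(ℝ, E) x y) v w := by
      filter_upwards [(chartAt E x).open_source.mem_nhds hy] with y' hy'
      rw [← g.localMetric_extChartAt hy', tangentCoord_chartField hy', tangentCoord_chartField hy']
    have hd : HasFDerivAt (fun z ↦ g.localMetric x z v w)
      (((fderiv ℝ (g.localMetric x) z).flip v).flip w) z := by
      have := (hz.hasFDerivAt.clm_apply (hasFDerivAt_const v _)).clm_apply (hasFDerivAt_const w _)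
      convert! this using 1
      ext u
      simp
    have hcomp := hd.hasMFDerivAt.comp y (mdifferentiableAt_extChartAt (I := 𝓘(ℝ, E)) hy).hasMFDerivAt
    rw [mvfderiv_congr heq]
    have h2 := congr($(hcomp.mfderiv) (chartField x u y))
    refine Eq.trans ?_ h2.symm
    change _ = fderiv ℝ (g.localMetric x) z (mfderiv 𝓘(ℝ, E) 𝓘(ℝ, E) (extChartAt 𝓘(ℝ, E) x) y (chartField x u y)) v w
    rw [← tangentCoord_eq_mfderiv hy, tangentCoord_chartField hy]
  have htor (u v : E) : g.leviCivita (chartField x v) y (chartField x u y) =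
      g.leviCivita (chartField x u) y (chartField x v y) := by
    have h := CovariantDerivative.torsion_apply g.leviCivita (mdiffAt_chartField hy u)
      (mdiffAt_chartField hy v)
    rw [mlieBracket_chartField hy, g.leviCivita_torsion] at h
    exact sub_eq_zero.1 ((sub_zero _).symm.trans h.symm)
  set u := tangentCoord x ⟨y, u'⟩ with hu
  have hu' : u' = chartField x u y := (chartField_tangentCoord hy u').symm
  -- The Koszul argument: by nondegeneracy it suffices to pair with each `w`. Three instances of
  -- compatibility, combined using torsion-freeness and vanishing brackets, determine the
  -- connection.
  refine (g.isInvertible_localMetric hy).injective ?_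
  ext w
  rw [g.localMetric_localChristoffel hy, localChristoffelFirst_apply]
  have e1 := g.localMetric_extChartAt hy (g.leviCivita (chartField x v) y u') (chartField x w y)
  rw [tangentCoord_chartField hy] at e1
  rw [e1, hu', hmet, hmet, hmet, htor w v, htor w u, htor v u,
    g.symm y (chartField x v y), g.symm y (chartField x u y)]
  ring

end LorentzMetric

/-! ### The covariant derivative along a map in a fixed chart -/

section Along

variable {E : Type*} [NormedAddCommGroup E] [NormedSpace ℝ E]
  {M : Type*} [TopologicalSpace M] [ChartedSpace E M] [IsManifold 𝓘(ℝ, E) ∞ M]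
  {E' : Type*} [NormedAddCommGroup E'] [NormedSpace ℝ E']
  {V : Type*} [TopologicalSpace V] [ChartedSpace E' V] [IsManifold 𝓘(ℝ, E') ∞ V]
  {F : Type*} [NormedAddCommGroup F] [NormedSpace ℝ F]

lemma mvfderiv_clm_apply {A : V → E →L[ℝ] F} {s : V → E} {q : V}
    (hA : MDifferentiableAt 𝓘(ℝ, E') 𝓘(ℝ, E →L[ℝ] F) A q)
    (hs : MDifferentiableAt 𝓘(ℝ, E') 𝓘(ℝ, E) s q) (u : TangentSpace 𝓘(ℝ, E') q) :
    MDifferentiableAt 𝓘(ℝ, E') 𝓘(ℝ, F) (fun q ↦ A q (s q)) q ∧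
    mvfderiv 𝓘(ℝ, E') (fun q ↦ A q (s q)) q u =
      A q (mvfderiv 𝓘(ℝ, E') s q u) + mvfderiv 𝓘(ℝ, E') A q u (s q) := by
  have hq := mem_chart_source E' q
  have hA' := (mdifferentiableAt_iff_comp_symm hq).1 hA
  have hs' := (mdifferentiableAt_iff_comp_symm hq).1 hs
  have h : MDifferentiableAt 𝓘(ℝ, E') 𝓘(ℝ, F) (fun q ↦ A q (s q)) q :=
    (mdifferentiableAt_iff_comp_symm hq).2 (hA'.clm_apply hs')
  refine ⟨h, ?_⟩
  rw [mvfderiv_eq_fderiv_comp_symm hq h, mvfderiv_eq_fderiv_comp_symm hq hA,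
    mvfderiv_eq_fderiv_comp_symm hq hs]
  have := congr($((hA'.hasFDerivAt.clm_apply hs'.hasFDerivAt).fderiv) (tangentCoord q ⟨q, u⟩))
  simp only [Function.comp_apply, extChartAt_to_inv] at this
  exact this

/-- `T` is the transition function of the tangent bundle. Its differentiability allows the Leibniz
rule when passing from the chart centred at a point to a fixed chart. -/
lemma exists_tangentCoord_change {x x' : M} {y : M} (hx : y ∈ (chartAt E x).source)
    (hx' : y ∈ (chartAt E x').source) :
    ∃ T : M → E →L[ℝ] E, MDifferentiableAt 𝓘(ℝ, E) 𝓘(ℝ, E →L[ℝ] E) T y ∧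
      ∀ᶠ y' in 𝓝 y, ∀ v : TangentSpace 𝓘(ℝ, E) y',
        tangentCoord x' ⟨y', v⟩ = T y' (tangentCoord x ⟨y', v⟩) := by
  have hb : y ∈ (trivializationAt E (TangentSpace 𝓘(ℝ, E)) x).baseSet := by
    rwa [TangentBundle.trivializationAt_baseSet]
  have hb' : y ∈ (trivializationAt E (TangentSpace 𝓘(ℝ, E)) x').baseSet := by
    rwa [TangentBundle.trivializationAt_baseSet]
  refine ⟨fun y ↦ (trivializationAt E (TangentSpace 𝓘(ℝ, E)) x).coordChangeL ℝ
    (trivializationAt E (TangentSpace 𝓘(ℝ, E)) x') y, ?_, ?_⟩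
  · exact (ContMDiffAt.coordChangeL (n := 1) (IB := 𝓘(ℝ, E)) (IM := 𝓘(ℝ, E)) (f := fun y ↦ y)
      contMDiffAt_id hb hb').mdifferentiableAt (by simp)
  · filter_upwards [(trivializationAt E (TangentSpace 𝓘(ℝ, E)) x).open_baseSet.mem_nhds hb,
      (trivializationAt E (TangentSpace 𝓘(ℝ, E)) x').open_baseSet.mem_nhds hb'] with y' h h' v
    refine Eq.symm ((Trivialization.coordChangeL_apply _ _ ⟨h, h'⟩ _).trans ?_)
    exact congr(tangentCoord x' ⟨y',
      $((trivializationAt E (TangentSpace 𝓘(ℝ, E)) x).symm_apply_apply_mk h v)⟩)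

/-- The covariant derivative along a map in a fixed chart. -/
lemma tangentCoord_covDerivAlong [FiniteDimensional ℝ E] (g : LorentzMetric E M) {f : V → M}
    {q : V} {x : M} (hx : f q ∈ (chartAt E x).source)
    (hf : MDifferentiableAt 𝓘(ℝ, E') 𝓘(ℝ, E) f q)
    {W : Π q : V, TangentSpace 𝓘(ℝ, E) (f q)}
    (hW : MDifferentiableAt 𝓘(ℝ, E') 𝓘(ℝ, E) (fun q ↦ tangentCoord x ⟨f q, W q⟩) q)
    (u : TangentSpace 𝓘(ℝ, E') q) :
    tangentCoord x ⟨f q, covDerivAlong g f W q u⟩ =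
      mvfderiv 𝓘(ℝ, E') (fun q ↦ tangentCoord x ⟨f q, W q⟩) q u +
        g.localChristoffel x (extChartAt 𝓘(ℝ, E) x (f q)) (tangentCoord x ⟨f q, W q⟩)
          (tangentCoord x ⟨f q, mfderiv 𝓘(ℝ, E') 𝓘(ℝ, E) f q u⟩) := by
  obtain ⟨T, hT, hTx⟩ := exists_tangentCoord_change hx (mem_chart_source E (f q))
  have hTf : MDifferentiableAt 𝓘(ℝ, E') 𝓘(ℝ, E →L[ℝ] E) (fun q ↦ T (f q)) q := hT.comp q hf
  have h1 : (fun q' ↦ tangentCoord (f q) ⟨f q', W q'⟩) =ᶠ[𝓝 q]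
      fun q' ↦ T (f q') (tangentCoord x ⟨f q', W q'⟩) := by
    filter_upwards [hf.continuousAt.eventually hTx] with q' h using h _
  have h2 := congr($(mvfderiv_congr h1) u).trans (mvfderiv_clm_apply hTf hW u).2
  set v : E := tangentCoord x ⟨f q, W q⟩ with hv
  -- The Leibniz rule leaves a term with the derivative of `T`. Since `T y v` represents the field
  -- with constant components `v`, that term and the Christoffel term together are the Levi-Civita
  -- derivative of this field; no transformation law for Christoffel symbols is required.
  have h3 : (fun y ↦ tangentCoord (f q) ⟨y, chartField x v y⟩) =ᶠ[𝓝 (f q)] fun y ↦ T y v := by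
    filter_upwards [hTx, (chartAt E x).open_source.mem_nhds hx] with y h hy
    rw [h, tangentCoord_chartField hy]
  have h4 := (mvfderiv_clm_apply hT (mdifferentiableAt_const (c := v))
    (mfderiv 𝓘(ℝ, E') 𝓘(ℝ, E) f q u)).2
  rw [mvfderiv_const, zero_apply, map_zero, zero_add] at h4
  have h5 : mvfderiv 𝓘(ℝ, E') (fun q ↦ T (f q)) q u =
      mvfderiv 𝓘(ℝ, E) T (f q) (mfderiv 𝓘(ℝ, E') 𝓘(ℝ, E) f q u) :=
    congr($(mfderiv_comp (I := 𝓘(ℝ, E')) (I' := 𝓘(ℝ, E)) (I'' := 𝓘(ℝ, E →L[ℝ] E)) q hT hf) u)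
  have h6 := g.leviCivita_apply (chartField x v) (f q) (mfderiv 𝓘(ℝ, E') 𝓘(ℝ, E) f q u)
  rw [mvfderiv_congr h3, h4, hv, chartField_tangentCoord hx, ← hv] at h6
  obtain ⟨l, hl⟩ : ∃ l : E, l =
      g.leviCivita (chartField x v) (f q) (mfderiv 𝓘(ℝ, E') 𝓘(ℝ, E) f q u) := ⟨_, rfl⟩
  have h7 : (covDerivAlong g f W q u : E) =
      T (f q) (mvfderiv 𝓘(ℝ, E') (fun q ↦ tangentCoord x ⟨f q, W q⟩) q u) + l := by
    have h8 : (covDerivAlong g f W q u : E) =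
      mvfderiv 𝓘(ℝ, E') (fun q' ↦ tangentCoord (f q) ⟨f q', W q'⟩) q u +
        g.christoffel (f q) (W q) (mfderiv 𝓘(ℝ, E') 𝓘(ℝ, E) f q u) := rfl
    rw [h8, h2, h5]
    rw [hl.trans h6]
    exact add_assoc (G := E) _ _ _
  rw [← g.tangentCoord_leviCivita_chartField hx]
  set a : E := mvfderiv 𝓘(ℝ, E') (fun q ↦ tangentCoord x ⟨f q, W q⟩) q u with ha
  have h9 : T (f q) a = chartField x a (f q) := by
    have := hTx.self_of_nhds (chartField x a (f q))
    rw [tangentCoord_chartField hx] at this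
    rw [← this]
    exact tangentCoord_self _ _
  rw [h9, hl] at h7
  have h10 : covDerivAlong g f W q u = chartField x a (f q) +
      g.leviCivita (chartField x v) (f q) (mfderiv 𝓘(ℝ, E') 𝓘(ℝ, E) f q u) := h7
  rw [h10, tangentCoord_add (by rwa [TangentBundle.trivializationAt_baseSet]),
    tangentCoord_chartField hx]

end Along

/-! ### Curvature from Christoffel symbols on a vector space -/

section Calculus

variable {E : Type*} [NormedAddCommGroup E] [NormedSpace ℝ E]
  {E' : Type*} [NormedAddCommGroup E'] [NormedSpace ℝ E']

/-- The curvature of a connection on the vector space `E` in terms of its Christoffel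
symbols `Γ`. -/
def christoffelCurvature (Γ : E → E →L[ℝ] E →L[ℝ] E) (z a b c : E) : E :=
  fderiv ℝ Γ z a c b - fderiv ℝ Γ z b c a + Γ z (Γ z c b) a - Γ z (Γ z c a) b

/-- The covariant derivative along `φ` of a field `W` in terms of Christoffel symbols. -/
def christoffelDeriv (Γ : E → E →L[ℝ] E →L[ℝ] E) (φ : E' → E) (W : E' → E) (u : E')
    (z : E') : E :=
  fderiv ℝ W z u + Γ (φ z) (W z) (fderiv ℝ φ z u)

/-- The field already contains second derivatives of `φ`, which is why three derivatives are
assumed. -/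
lemma differentiableAt_christoffelDeriv {Γ : E → E →L[ℝ] E →L[ℝ] E} {φ : E' → E} {z : E'}
    (hΓ : DifferentiableAt ℝ Γ (φ z)) (hφ : ContDiffAt ℝ 3 φ z) (v w : E') :
    DifferentiableAt ℝ (christoffelDeriv Γ φ (fun z ↦ fderiv ℝ φ z w) v) z := by
  have h1 : ContDiffAt ℝ 2 (fderiv ℝ φ) z := hφ.fderiv_right (by norm_num)
  have h2 : ContDiffAt ℝ 1 (fderiv ℝ (fun z ↦ fderiv ℝ φ z w)) z :=
    (h1.clm_apply contDiffAt_const).fderiv_right (by norm_num)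
  have h3 := h1.differentiableAt (by norm_num)
  have h4 := hφ.differentiableAt (by norm_num)
  have h5 : DifferentiableAt ℝ (fun z ↦ Γ (φ z)) z := hΓ.comp z h4
  exact ((h2.differentiableAt (by norm_num)).clm_apply (differentiableAt_const _)).add
    ((h5.clm_apply (h3.clm_apply (differentiableAt_const _))).clm_apply
      (h3.clm_apply (differentiableAt_const _)))

/-- The directions are constant, so no bracket term appears. On antisymmetrizing in `u`, `v` the
third derivatives of `φ` and all terms with one second derivative cancel; only the derivative of `Γ`
and the quadratic terms remain. Neither injectivity of `Dφ` nor symmetry of `Γ` enters. -/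
lemma christoffelDeriv_comm {Γ : E → E →L[ℝ] E →L[ℝ] E} {φ : E' → E} {z : E'}
    (hΓ : DifferentiableAt ℝ Γ (φ z)) (hφ : ContDiffAt ℝ 3 φ z) (u v w : E') :
    christoffelDeriv Γ φ (christoffelDeriv Γ φ (fun z ↦ fderiv ℝ φ z w) v) u z -
      christoffelDeriv Γ φ (christoffelDeriv Γ φ (fun z ↦ fderiv ℝ φ z w) u) v z =
    christoffelCurvature Γ (φ z) (fderiv ℝ φ z u) (fderiv ℝ φ z v) (fderiv ℝ φ z w) := by
  have h1 : ContDiffAt ℝ 2 (fderiv ℝ φ) z := hφ.fderiv_right (by norm_num)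
  have h2 : ContDiffAt ℝ 1 (fderiv ℝ (fun z ↦ fderiv ℝ φ z w)) z :=
    (h1.clm_apply contDiffAt_const).fderiv_right (by norm_num)
  have h2s : IsSymmSndFDerivAt ℝ (fun z ↦ fderiv ℝ φ z w) z :=
    (h1.clm_apply contDiffAt_const).isSymmSndFDerivAt (by simp)
  have h0s : IsSymmSndFDerivAt ℝ φ z := (hφ.of_le (m := 2) (by norm_num)).isSymmSndFDerivAt (by simp)
  have h3 := h1.differentiableAt (by norm_num)
  have h4 := hφ.differentiableAt (by norm_num)
  have h5 : HasFDerivAt (fun z ↦ Γ (φ z)) ((fderiv ℝ Γ (φ z)).comp (fderiv ℝ φ z)) z :=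
    hΓ.hasFDerivAt.comp z h4.hasFDerivAt
  have h6 (w : E') : fderiv ℝ (fun z ↦ fderiv ℝ φ z w) z = (fderiv ℝ (fderiv ℝ φ) z).flip w := by
    have := h3.hasFDerivAt.clm_apply (hasFDerivAt_const w _)
    rw [this.fderiv]
    simp
  have key (u v : E') : christoffelDeriv Γ φ (christoffelDeriv Γ φ (fun z ↦ fderiv ℝ φ z w) v) u z =
      fderiv ℝ (fderiv ℝ (fun z ↦ fderiv ℝ φ z w)) z u v +
      (fderiv ℝ Γ (φ z) (fderiv ℝ φ z u) (fderiv ℝ φ z w) (fderiv ℝ φ z v)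
        + Γ (φ z) (fderiv ℝ (fderiv ℝ φ) z u w) (fderiv ℝ φ z v)
        + Γ (φ z) (fderiv ℝ φ z w) (fderiv ℝ (fderiv ℝ φ) z u v))
      + (Γ (φ z) (fderiv ℝ (fderiv ℝ φ) z v w) (fderiv ℝ φ z u)
        + Γ (φ z) (Γ (φ z) (fderiv ℝ φ z w) (fderiv ℝ φ z v)) (fderiv ℝ φ z u)) := by
    have hd := ((h2.differentiableAt (by norm_num)).hasFDerivAt.clm_apply
      (hasFDerivAt_const v _)).add
      ((h5.clm_apply (h3.hasFDerivAt.clm_apply (hasFDerivAt_const w _))).clm_apply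
      (h3.hasFDerivAt.clm_apply (hasFDerivAt_const v _)))
    have hd' : fderiv ℝ (christoffelDeriv Γ φ (fun z ↦ fderiv ℝ φ z w) v) z = _ := hd.fderiv
    rw [christoffelDeriv, hd', christoffelDeriv, h6]
    simp
    abel
  rw [key, key, h2s.eq u v, h0s.eq u v, christoffelCurvature]
  abel

/-- Compatibility of the connection with the bilinear form `G` makes the curvature skew. -/
lemma christoffelCurvature_skew {Γ : E → E →L[ℝ] E →L[ℝ] E} {G : E → E →L[ℝ] E →L[ℝ] ℝ} {z : E}
    (hΓ : DifferentiableAt ℝ Γ z) (hG : ContDiffAt ℝ 2 G z)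
    (hm : ∀ᶠ z in 𝓝 z, ∀ u v w, fderiv ℝ G z u v w = G z (Γ z v u) w + G z v (Γ z w u))
    (u v s t : E) :
    G z (christoffelCurvature Γ z u v s) t + G z s (christoffelCurvature Γ z u v t) = 0 := by
  have h0s : IsSymmSndFDerivAt ℝ G z := hG.isSymmSndFDerivAt (by simp)
  have hG1 := (hG.differentiableAt (by norm_num)).hasFDerivAt
  have hG2 := ((hG.fderiv_right (m := 1) (by norm_num)).differentiableAt (by norm_num)).hasFDerivAt
  have hz := hm.self_of_nhds
  -- The compatibility identity differentiated once more.
  have key (u v : E) : fderiv ℝ (fderiv ℝ G) z u v s t =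
      (fderiv ℝ G z u (Γ z s v) t + G z (fderiv ℝ Γ z u s v) t) +
      (fderiv ℝ G z u s (Γ z t v) + G z s (fderiv ℝ Γ z u t v)) := by
    have h1 := ((hG2.clm_apply (hasFDerivAt_const v _)).clm_apply
      (hasFDerivAt_const s _)).clm_apply (hasFDerivAt_const t _)
    have hΓ' (s : E) := (hΓ.hasFDerivAt.clm_apply (hasFDerivAt_const s _)).clm_apply
      (hasFDerivAt_const v z)
    have h2 := ((hG1.clm_apply (hΓ' s)).clm_apply (hasFDerivAt_const t _)).add
      ((hG1.clm_apply (hasFDerivAt_const s _)).clm_apply (hΓ' t))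
    have h3 : (fun z ↦ fderiv ℝ G z v s t) =ᶠ[𝓝 z]
        (fun z ↦ G z (Γ z s v) t) + fun z ↦ G z s (Γ z t v) := by
      filter_upwards [hm] with z hz using hz v s t
    have h4 := congr($((h2.congr_of_eventuallyEq h3).unique h1) u)
    simp at h4
    linarith
  -- Symmetry of the second derivative of `G` in `u`, `v`; eliminating first derivatives of `G` by
  -- compatibility leaves exactly the curvature terms.
  have h5 := key u v
  rw [h0s.eq u v, key v u] at h5
  simp only [hz, christoffelCurvature, map_add, map_sub, add_apply, sub_apply] at h5 ⊢
  linarith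

end Calculus

/-! ### Immersions in charts and the curvature of a restricted connection -/

section LocalMap

variable {E : Type*} [NormedAddCommGroup E] [NormedSpace ℝ E]
  {M : Type*} [TopologicalSpace M] [ChartedSpace E M] [IsManifold 𝓘(ℝ, E) ∞ M]
  {E' : Type*} [NormedAddCommGroup E'] [NormedSpace ℝ E']
  {V : Type*} [TopologicalSpace V] [ChartedSpace E' V] [IsManifold 𝓘(ℝ, E') ∞ V]
  {F : Type*} [NormedAddCommGroup F] [NormedSpace ℝ F]

lemma mvfderiv_comp_extChartAt {k : E → F} {x y : M} (hy : y ∈ (chartAt E x).source)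
    (hk : DifferentiableAt ℝ k (extChartAt 𝓘(ℝ, E) x y)) :
    MDifferentiableAt 𝓘(ℝ, E) 𝓘(ℝ, F) (k ∘ extChartAt 𝓘(ℝ, E) x) y ∧
    ∀ u : TangentSpace 𝓘(ℝ, E) y, mvfderiv 𝓘(ℝ, E) (k ∘ extChartAt 𝓘(ℝ, E) x) y u =
      fderiv ℝ k (extChartAt 𝓘(ℝ, E) x y) (tangentCoord x ⟨y, u⟩) := by
  have hφ := mdifferentiableAt_extChartAt (I := 𝓘(ℝ, E)) hy
  refine ⟨hk.mdifferentiableAt.comp y hφ, fun u ↦ ?_⟩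
  have h1 := mfderiv_comp (I' := 𝓘(ℝ, E)) (I := 𝓘(ℝ, E)) (I'' := 𝓘(ℝ, F)) y
    hk.mdifferentiableAt hφ
  rw [tangentCoord_eq_mfderiv hy]
  rw [mfderiv_eq_fderiv] at h1
  exact congr($h1 u)

/-- The map `f` in the charts at `p` and at `f p`. -/
def localMap (f : V → M) (p : V) : E' → E :=
  (extChartAt 𝓘(ℝ, E) (f p) ∘ f) ∘ (extChartAt 𝓘(ℝ, E') p).symm

lemma localMap_extChartAt (f : V → M) {p q : V} (hq : q ∈ (chartAt E' p).source) :
    localMap (E := E) f p (extChartAt 𝓘(ℝ, E') p q) = extChartAt 𝓘(ℝ, E) (f p) (f q) := by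
  rw [localMap, Function.comp_apply, (extChartAt 𝓘(ℝ, E') p).left_inv
    (by rwa [extChartAt_source]), Function.comp_apply]

lemma contDiffAt_localMap {f : V → M} {p q : V} {n : ℕ∞} (hq : q ∈ (chartAt E' p).source)
    (hx : f q ∈ (chartAt E (f p)).source) (hf : ContMDiffAt 𝓘(ℝ, E') 𝓘(ℝ, E) n f q) :
    ContDiffAt ℝ n (localMap (E := E) f p) (extChartAt 𝓘(ℝ, E') p q) := by
  have : IsManifold 𝓘(ℝ, E) n M := .of_le (n := ∞) (mod_cast le_top)
  exact (contMDiffAt_iff_comp_symm hq).1 ((contMDiffAt_extChartAt' hx).comp q hf)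

lemma tangentCoord_mfderiv_localMap {f : V → M} {p q : V} (hq : q ∈ (chartAt E' p).source)
    (hx : f q ∈ (chartAt E (f p)).source) (hf : MDifferentiableAt 𝓘(ℝ, E') 𝓘(ℝ, E) f q)
    (u : TangentSpace 𝓘(ℝ, E') q) :
    tangentCoord (f p) ⟨f q, mfderiv 𝓘(ℝ, E') 𝓘(ℝ, E) f q u⟩ =
      fderiv ℝ (localMap (E := E) f p) (extChartAt 𝓘(ℝ, E') p q) (tangentCoord p ⟨q, u⟩) :=
  tangentCoord_mfderiv hq hx hf u

lemma eventually_mem_sources {f : V → M} {p : V} (hf : ContinuousAt f p) :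
    ∀ᶠ q in 𝓝 p, q ∈ (chartAt E' p).source ∧ f q ∈ (chartAt E (f p)).source :=
  (eventually_mem_chartAt_source p).and (hf.eventually (eventually_mem_chartAt_source (f p)))

/-- The bridge to the vector-space calculus. It holds at each `q` of the chart domain that `f` maps
into the chart at `f p`, so the outcome can be differentiated again. -/
lemma tangentCoord_covDerivAlong_localMap [FiniteDimensional ℝ E] (g : LorentzMetric E M)
    {f : V → M} {p q : V} (hq : q ∈ (chartAt E' p).source) (hx : f q ∈ (chartAt E (f p)).source)
    (hf : MDifferentiableAt 𝓘(ℝ, E') 𝓘(ℝ, E) f q)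
    {W : Π q : V, TangentSpace 𝓘(ℝ, E) (f q)} {W' : E' → E}
    (hW' : DifferentiableAt ℝ W' (extChartAt 𝓘(ℝ, E') p q))
    (hW : ∀ᶠ q' in 𝓝 q, tangentCoord (f p) ⟨f q', W q'⟩ = W' (extChartAt 𝓘(ℝ, E') p q'))
    (u : TangentSpace 𝓘(ℝ, E') q) :
    tangentCoord (f p) ⟨f q, covDerivAlong g f W q u⟩ =
      christoffelDeriv (g.localChristoffel (f p)) (localMap f p) W' (tangentCoord p ⟨q, u⟩)
        (extChartAt 𝓘(ℝ, E') p q) := by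
  have hW2 : (fun q ↦ tangentCoord (f p) ⟨f q, W q⟩) =ᶠ[𝓝 q] W' ∘ extChartAt 𝓘(ℝ, E') p := hW
  obtain ⟨h1, h2⟩ := mvfderiv_comp_extChartAt hq hW'
  rw [tangentCoord_covDerivAlong g hx hf (h1.congr_of_eventuallyEq hW2), mvfderiv_congr hW2, h2,
    hW.self_of_nhds, tangentCoord_mfderiv_localMap hq hx hf, christoffelDeriv,
    localMap_extChartAt f hq]

/-- For a fixed left inverse `L` of the map at the centre, `L ∘ A` is the identity there and hence
invertible nearby, so `(L ∘ A)⁻¹ ∘ L` is a smooth left inverse. -/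
lemma exists_contDiffAt_leftInverse [FiniteDimensional ℝ E] [FiniteDimensional ℝ E']
    {A : E' → E' →L[ℝ] E} {z : E'} (hA : ContDiffAt ℝ ∞ A z) (hi : Function.Injective (A z)) :
    ∃ B : E' → E →L[ℝ] E', ContDiffAt ℝ ∞ B z ∧ ∀ᶠ z in 𝓝 z, ∀ u, B z (A z u) = u := by
  have : CompleteSpace E' := FiniteDimensional.complete ℝ E'
  obtain ⟨L, hL⟩ := (A z : E' →ₗ[ℝ] E).exists_leftInverse_of_injective
    (LinearMap.ker_eq_bot.2 hi)
  set L' : E →L[ℝ] E' := L.toContinuousLinearMap with hL'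
  have hLA : L'.comp (A z) = (ContinuousLinearEquiv.refl ℝ E' : E' →L[ℝ] E') := by
    ext u
    exact congr($hL u)
  have hC : ContDiffAt ℝ ∞ (fun z ↦ L'.comp (A z)) z := contDiffAt_const.clm_comp hA
  refine ⟨fun z ↦ (L'.comp (A z)).inverse.comp L', ?_, ?_⟩
  · obtain ⟨e, he⟩ : ∃ e : E' ≃L[ℝ] E', (e : E' →L[ℝ] E') = L'.comp (A z) := ⟨_, hLA.symm⟩
    have h1 := contDiffAt_map_inverse (𝕜 := ℝ) (n := ∞) e
    rw [he] at h1
    have h2 : ContDiffAt ℝ ∞ (fun z ↦ (L'.comp (A z)).inverse) z :=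
      ContDiffAt.comp (g := ContinuousLinearMap.inverse) z h1 hC
    exact h2.clm_comp contDiffAt_const
  · have h2 := ContinuousLinearEquiv.nhds (𝕜 := ℝ) (ContinuousLinearEquiv.refl ℝ E')
    rw [← hLA] at h2
    filter_upwards [hC.continuousAt.eventually h2] with z ⟨e, he⟩ u
    change (L'.comp (A z)).inverse (L'.comp (A z) u) = u
    rw [← he]
    simp

lemma fderiv_localMap_injective {f : V → M} {p : V}
    (hf : MDifferentiableAt 𝓘(ℝ, E') 𝓘(ℝ, E) f p)
    (hi : Function.Injective (mfderiv 𝓘(ℝ, E') 𝓘(ℝ, E) f p)) :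
    Function.Injective (fderiv ℝ (localMap (E := E) f p) (extChartAt 𝓘(ℝ, E') p p)) := by
  intro u v h
  have h1 (u : TangentSpace 𝓘(ℝ, E') p) : mfderiv 𝓘(ℝ, E') 𝓘(ℝ, E) f p u =
      fderiv ℝ (localMap (E := E) f p) (extChartAt 𝓘(ℝ, E') p p) u := by
    have := tangentCoord_mfderiv_localMap (mem_chart_source E' p) (mem_chart_source E (f p)) hf u
    rwa [tangentCoord_self, tangentCoord_self] at this
  exact hi ((h1 u).trans (h.trans (h1 v).symm))

/-- A vector field whose image under an immersion is differentiable is differentiable. -/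
lemma mdiffAt_of_pushField [FiniteDimensional ℝ E] [FiniteDimensional ℝ E'] {f : V → M} {p : V}
    (hf : ContMDiff 𝓘(ℝ, E') 𝓘(ℝ, E) ∞ f)
    (hi : Function.Injective (mfderiv 𝓘(ℝ, E') 𝓘(ℝ, E) f p))
    {U : Π q : V, TangentSpace 𝓘(ℝ, E') q} {W' : E' → E}
    (hW' : DifferentiableAt ℝ W' (extChartAt 𝓘(ℝ, E') p p))
    (hU : ∀ᶠ q in 𝓝 p, tangentCoord (f p) ⟨f q, pushField f U q⟩ = W' (extChartAt 𝓘(ℝ, E') p q)) :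
    MDiffAt (T% U) p := by
  have hfd (q : V) : MDifferentiableAt 𝓘(ℝ, E') 𝓘(ℝ, E) f q := (hf q).mdifferentiableAt (by simp)
  have hφ := contDiffAt_localMap (n := ⊤) (mem_chart_source E' p) (mem_chart_source E (f p)) (hf p)
  -- A differentiable left inverse of `Dφ` recovers the coordinates of `U` from those of its image.
  obtain ⟨B, hB, hBA⟩ := exists_contDiffAt_leftInverse
    (hφ.fderiv_right (m := ∞) (by simp)) (fderiv_localMap_injective (hfd p) hi)
  rw [mdiffAt_iff_tangentCoord (mem_chart_source E' p)]
  have hd : DifferentiableAt ℝ (fun z ↦ B z (W' z)) (extChartAt 𝓘(ℝ, E') p p) :=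
    (hB.differentiableAt (by simp)).clm_apply hW'
  refine (mvfderiv_comp_extChartAt (mem_chart_source E' p) hd).1.congr_of_eventuallyEq ?_
  filter_upwards [hU, (continuousAt_extChartAt p).eventually hBA,
    eventually_mem_sources (E := E) (E' := E') (hfd p).continuousAt] with q h1 h2 ⟨hq, hx⟩
  rw [Function.comp_apply, ← h1, pushField, tangentCoord_mfderiv_localMap hq hx (hfd q), h2]

/-- The covariant derivative of a tangent vector field along an immersion, in charts. -/
lemma tangentCoord_covDerivAlong_pushField [FiniteDimensional ℝ E] (g : LorentzMetric E M)
    {f : V → M} (hf : ContMDiff 𝓘(ℝ, E') 𝓘(ℝ, E) ∞ f) {p q : V}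
    (hq : q ∈ (chartAt E' p).source) (hx : f q ∈ (chartAt E (f p)).source)
    {Y : Π q : V, TangentSpace 𝓘(ℝ, E') q} {Y' : E' → E'}
    (hY' : DifferentiableAt ℝ Y' (extChartAt 𝓘(ℝ, E') p q))
    (hY : ∀ᶠ q' in 𝓝 q, tangentCoord p ⟨q', Y q'⟩ = Y' (extChartAt 𝓘(ℝ, E') p q'))
    (u : TangentSpace 𝓘(ℝ, E') q) :
    tangentCoord (f p) ⟨f q, covDerivAlong g f (pushField f Y) q u⟩ =
      christoffelDeriv (g.localChristoffel (f p)) (localMap f p)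
        (fun z ↦ fderiv ℝ (localMap (E := E) f p) z (Y' z)) (tangentCoord p ⟨q, u⟩)
        (extChartAt 𝓘(ℝ, E') p q) := by
  have hfd (q : V) : MDifferentiableAt 𝓘(ℝ, E') 𝓘(ℝ, E) f q := (hf q).mdifferentiableAt (by simp)
  have hφ : ContDiffAt ℝ ∞ (localMap (E := E) f p) (extChartAt 𝓘(ℝ, E') p q) :=
    contDiffAt_localMap (n := ⊤) hq hx (hf q)
  have hφ' : DifferentiableAt ℝ (fderiv ℝ (localMap (E := E) f p)) (extChartAt 𝓘(ℝ, E') p q) :=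
    (hφ.fderiv_right (m := ∞) (by simp)).differentiableAt (by simp)
  refine tangentCoord_covDerivAlong_localMap g hq hx (hfd q) (hφ'.clm_apply hY') ?_ u
  filter_upwards [hY, (chartAt E' p).open_source.mem_nhds hq,
    (hfd q).continuousAt ((chartAt E (f p)).open_source.mem_nhds hx)] with q' h h' h''
  rw [pushField, tangentCoord_mfderiv_localMap h' h'' (hfd q'), h]

/-- The curvature of a connection on an immersed submanifold which is mapped to the Levi-Civita
connection of the ambient manifold. -/
lemma tangentCoord_mfderiv_curvatureTensor [FiniteDimensional ℝ E] [FiniteDimensional ℝ E']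
    (g : LorentzMetric E M) {f : V → M} (hf : ContMDiff 𝓘(ℝ, E') 𝓘(ℝ, E) ∞ f)
    (hi : ∀ p, Function.Injective (mfderiv 𝓘(ℝ, E') 𝓘(ℝ, E) f p))
    (cov : CovariantDerivative 𝓘(ℝ, E') E' (TangentSpace 𝓘(ℝ, E') : V → Type _))
    (hcov : ∀ (p : V) (u : TangentSpace 𝓘(ℝ, E') p) (Y : Π q : V, TangentSpace 𝓘(ℝ, E') q),
      MDiffAt (T% Y) p →
        mfderiv 𝓘(ℝ, E') 𝓘(ℝ, E) f p (cov Y p u) = covDerivAlong g f (pushField f Y) p u)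
    (p : V) (x y z : TangentSpace 𝓘(ℝ, E') p) :
    tangentCoord (f p) ⟨f p, mfderiv 𝓘(ℝ, E') 𝓘(ℝ, E) f p (curvatureTensor cov p x y z)⟩ =
      christoffelCurvature (g.localChristoffel (f p)) (extChartAt 𝓘(ℝ, E) (f p) (f p))
        (tangentCoord (f p) ⟨f p, mfderiv 𝓘(ℝ, E') 𝓘(ℝ, E) f p x⟩)
        (tangentCoord (f p) ⟨f p, mfderiv 𝓘(ℝ, E') 𝓘(ℝ, E) f p y⟩)
        (tangentCoord (f p) ⟨f p, mfderiv 𝓘(ℝ, E') 𝓘(ℝ, E) f p z⟩) := by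
  have hp := mem_chart_source E' p
  have hxp := mem_chart_source E (f p)
  have hfd (q : V) : MDifferentiableAt 𝓘(ℝ, E') 𝓘(ℝ, E) f q := (hf q).mdifferentiableAt (by simp)
  have hφ : ContDiffAt ℝ 3 (localMap (E := E) f p) (extChartAt 𝓘(ℝ, E') p p) :=
    contDiffAt_localMap (n := 3) hp hxp ((hf p).of_le (mod_cast le_top))
  have hΓ : DifferentiableAt ℝ (g.localChristoffel (f p))
      (localMap (E := E) f p (extChartAt 𝓘(ℝ, E') p p)) := by
    rw [localMap_extChartAt f hp]
    exact (g.contDiffAt_localChristoffel hxp).differentiableAt (by simp)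
  -- The inner derivative must be known on a neighbourhood of `p`, because the outer one
  -- differentiates it.
  have hfirst (v w : E') : ∀ᶠ q in 𝓝 p, tangentCoord (f p) ⟨f q, pushField f
      (fun q ↦ cov (chartField p w) q (chartField p v q)) q⟩ =
      christoffelDeriv (g.localChristoffel (f p)) (localMap f p)
        (fun z ↦ fderiv ℝ (localMap (E := E) f p) z w) v (extChartAt 𝓘(ℝ, E') p q) := by
    filter_upwards [eventually_mem_sources (E := E) (E' := E') (hfd p).continuousAt] with q ⟨hq, hx⟩
    rw [pushField, hcov q _ _ (mdiffAt_chartField hq w),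
      tangentCoord_covDerivAlong_pushField g hf hq hx (Y' := fun _ ↦ w) (differentiableAt_const _),
      tangentCoord_chartField hq]
    filter_upwards [(chartAt E' p).open_source.mem_nhds hq] with q' hq'
    exact tangentCoord_chartField hq' w
  have hsecond (u v w : E') : tangentCoord (f p) ⟨f p, mfderiv 𝓘(ℝ, E') 𝓘(ℝ, E) f p
      (cov (fun q ↦ cov (chartField p w) q (chartField p v q)) p (chartField p u p))⟩ =
      christoffelDeriv (g.localChristoffel (f p)) (localMap f p)
        (christoffelDeriv (g.localChristoffel (f p)) (localMap f p)
          (fun z ↦ fderiv ℝ (localMap (E := E) f p) z w) v) u (extChartAt 𝓘(ℝ, E') p p) := by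
    -- Differentiability of the image gives differentiability of the inner derivative as a field on
    -- `V`, which `hcov` demands before it can be used a second time.
    have hd := differentiableAt_christoffelDeriv hΓ hφ v w
    rw [hcov p _ _ (mdiffAt_of_pushField hf (hi p) hd (hfirst v w)),
      tangentCoord_covDerivAlong_localMap g hp hxp (hfd p) hd (hfirst v w),
      tangentCoord_chartField hp]
  have hR (x y z : E') : curvatureTensor cov p x y z =
      cov (fun q ↦ cov (chartField p z) q (chartField p y q)) p (chartField p x p) -
      cov (fun q ↦ cov (chartField p z) q (chartField p x q)) p (chartField p y p) := by
    have hb : VectorField.mlieBracket 𝓘(ℝ, E') (chartField p x) (chartField p y) p = 0 :=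
      LorentzMetric.mlieBracket_extend p x y
    change curvatureOfFields cov (chartField p x) (chartField p y) (chartField p z) p = _
    rw [curvatureOfFields, hb, map_zero]
    exact sub_zero _
  have hs (x y z : E') : tangentCoord (f p) ⟨f p, mfderiv 𝓘(ℝ, E') 𝓘(ℝ, E) f p (curvatureTensor cov p x y z)⟩ =
      christoffelDeriv (g.localChristoffel (f p)) (localMap f p)
        (christoffelDeriv (g.localChristoffel (f p)) (localMap f p)
          (fun w ↦ fderiv ℝ (localMap (E := E) f p) w z) y) x (extChartAt 𝓘(ℝ, E') p p) -
      christoffelDeriv (g.localChristoffel (f p)) (localMap f p)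
        (christoffelDeriv (g.localChristoffel (f p)) (localMap f p)
          (fun w ↦ fderiv ℝ (localMap (E := E) f p) w z) x) y (extChartAt 𝓘(ℝ, E') p p) := by
    rw [← hsecond, ← hsecond, hR, map_sub]
    simp only [tangentCoord_self]
    rfl
  have hc (u : TangentSpace 𝓘(ℝ, E') p) :
      fderiv ℝ (localMap (E := E) f p) (extChartAt 𝓘(ℝ, E') p p) u =
        tangentCoord (f p) ⟨f p, mfderiv 𝓘(ℝ, E') 𝓘(ℝ, E) f p u⟩ := by
    rw [tangentCoord_mfderiv_localMap hp hxp (hfd p), tangentCoord_self]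
  refine (hs x y z).trans ((christoffelDeriv_comm hΓ hφ x y z).trans ?_)
  exact congr(christoffelCurvature (g.localChristoffel (f p)) $(localMap_extChartAt f hp)
    $(hc x) $(hc y) $(hc z))

end LocalMap

/-! ### Ambient curvature, its skewness, and isotropic vectors -/

namespace LorentzMetric

variable {E : Type*} [NormedAddCommGroup E] [NormedSpace ℝ E]
  {M : Type*} [TopologicalSpace M] [ChartedSpace E M] [IsManifold 𝓘(ℝ, E) ∞ M]

/-- Makes the ambient manifold an instance of the immersion results, with the identity as immersion;
its curvature formula then comes from the same lemma as that of the hypersurface. -/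
lemma covDerivAlong_id (g : LorentzMetric E M) (Y : Π y : M, TangentSpace 𝓘(ℝ, E) y) (x : M)
    (u : TangentSpace 𝓘(ℝ, E) x) :
    covDerivAlong g (id : M → M) (pushField (id : M → M) Y) x u = g.leviCivita Y x u := by
  have h (y : M) : pushField (E := E) (E' := E) (id : M → M) Y y = Y y := by
    rw [pushField, mfderiv_id]
    rfl
  have h2 : (pushField (id : M → M) Y : Π y : M, TangentSpace 𝓘(ℝ, E) y) = Y := funext h
  have h3 : covDerivAlong g (id : M → M) Y x u = g.leviCivita Y x u := by
    simp only [covDerivAlong, mfderiv_id]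
    rfl
  exact congr(covDerivAlong g (id : M → M) $h2 x u).trans h3

/-- The curvature tensor in a chart. -/
lemma tangentCoord_curvatureTensor [FiniteDimensional ℝ E] (g : LorentzMetric E M) (x : M)
    (u v w : TangentSpace 𝓘(ℝ, E) x) :
    tangentCoord x ⟨x, curvatureTensor g.leviCivita x u v w⟩ =
      christoffelCurvature (g.localChristoffel x) (extChartAt 𝓘(ℝ, E) x x)
        (tangentCoord x ⟨x, u⟩) (tangentCoord x ⟨x, v⟩) (tangentCoord x ⟨x, w⟩) := by
  have h (x : M) (v : TangentSpace 𝓘(ℝ, E) x) : mfderiv 𝓘(ℝ, E) 𝓘(ℝ, E) (id : M → M) x v = v := by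
    rw [mfderiv_id]
    rfl
  have := tangentCoord_mfderiv_curvatureTensor g (f := (id : M → M)) contMDiff_id
    (fun p a b hab ↦ (h p a).symm.trans (hab.trans (h p b))) g.leviCivita
    (fun p u Y _ ↦ (h p _).trans (g.covDerivAlong_id Y p u).symm) x u v w
  simp only [h] at this
  exact this

/-- In the sum of the two Christoffel symbols of the first kind all derivatives except `∂_u g(v, w)`
cancel. This is the compatibility hypothesis of `christoffelCurvature_skew`. -/
lemma fderiv_localMetric_eq [FiniteDimensional ℝ E] (g : LorentzMetric E M) {x y : M}
    (hy : y ∈ (chartAt E x).source) (u v w : E) :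
    fderiv ℝ (g.localMetric x) (extChartAt 𝓘(ℝ, E) x y) u v w =
      g.localMetric x (extChartAt 𝓘(ℝ, E) x y)
        (g.localChristoffel x (extChartAt 𝓘(ℝ, E) x y) v u) w +
      g.localMetric x (extChartAt 𝓘(ℝ, E) x y) v
        (g.localChristoffel x (extChartAt 𝓘(ℝ, E) x y) w u) := by
  have hd := g.differentiableAt_localMetric hy
  rw [g.localMetric_symm x _ v, g.localMetric_localChristoffel hy,
    g.localMetric_localChristoffel hy, localChristoffelFirst_apply, localChristoffelFirst_apply,
    g.fderiv_localMetric_symm hd u w v, g.fderiv_localMetric_symm hd w v u,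
    g.fderiv_localMetric_symm hd v w u]
  ring

/-- Follows from the symmetry of the metric; it is what permits polarization of the geodesic
equation. -/
lemma localChristoffel_symm (g : LorentzMetric E M) {x y : M}
    (hy : y ∈ (chartAt E x).source) (u v : E) :
    g.localChristoffel x (extChartAt 𝓘(ℝ, E) x y) u v =
      g.localChristoffel x (extChartAt 𝓘(ℝ, E) x y) v u := by
  rw [localChristoffel_apply, localChristoffel_apply]
  congr 1
  ext w
  rw [localChristoffelFirst_apply, localChristoffelFirst_apply,
    g.fderiv_localMetric_symm (g.differentiableAt_localMetric hy) w u v]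
  ring

/-- The curvature operator of the Levi-Civita connection is skew. -/
lemma curvatureTensor_skew [FiniteDimensional ℝ E] (g : LorentzMetric E M) (x : M)
    (u v s t : TangentSpace 𝓘(ℝ, E) x) :
    g.val x (curvatureTensor g.leviCivita x u v s) t +
      g.val x s (curvatureTensor g.leviCivita x u v t) = 0 := by
  have hx := mem_chart_source E x
  have hm : ∀ᶠ z in 𝓝 (extChartAt 𝓘(ℝ, E) x x), ∀ u v w,
      fderiv ℝ (g.localMetric x) z u v w =
        g.localMetric x z (g.localChristoffel x z v u) w +
          g.localMetric x z v (g.localChristoffel x z w u) := by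
    filter_upwards [extChartAt_target_mem_nhds (I := 𝓘(ℝ, E)) x] with z hz
    have h := (extChartAt 𝓘(ℝ, E) x).map_target hz
    rw [extChartAt_source] at h
    rw [← (extChartAt 𝓘(ℝ, E) x).right_inv hz]
    exact g.fderiv_localMetric_eq h
  rw [← g.localMetric_extChartAt hx, ← g.localMetric_extChartAt hx,
    tangentCoord_curvatureTensor, tangentCoord_curvatureTensor]
  exact christoffelCurvature_skew ((g.contDiffAt_localChristoffel hx).differentiableAt (by simp))
    ((g.contDiffAt_localMetric hx).of_le (by norm_cast)) hm _ _ _ _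

/-- Two orthogonal isotropic vectors are proportional. -/
lemma exists_eq_smul_of_isotropic (g : LorentzMetric E M) (x : M)
    {v w : TangentSpace 𝓘(ℝ, E) x} (hv : g.val x v v = 0) (hw : g.val x w w = 0)
    (hvw : g.val x v w = 0) (h0 : v ≠ 0) : ∃ c : ℝ, w = c • v := by
  obtain ⟨t, -, hpos⟩ := g.signature x
  -- A nonzero vector orthogonal to the timelike `t` is spacelike, so `v` cannot be one.
  have htv : g.val x t v ≠ 0 := fun h ↦ (hpos v h0 h).ne' hv
  -- The coefficient makes `w - c • v` orthogonal to `t`. That vector is also isotropic, hence zero.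
  refine ⟨g.val x t w / g.val x t v, ?_⟩
  by_contra h
  refine (hpos (w - (g.val x t w / g.val x t v) • v) (sub_ne_zero.2 h) ?_).ne' ?_
  · simp only [map_sub, map_smul, smul_eq_mul]
    field_simp
    ring
  · simp only [map_sub, map_smul, smul_eq_mul, sub_apply, smul_apply, hv, hw, hvw,
      g.symm x w v]
    ring

end LorentzMetric

/-! ### Totally geodesic maps: covariant derivatives stay tangent -/

section TotallyGeodesic

variable {E : Type*} [NormedAddCommGroup E] [NormedSpace ℝ E]
  {M : Type*} [TopologicalSpace M] [ChartedSpace E M] [IsManifold 𝓘(ℝ, E) ∞ M]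
  {E' : Type*} [NormedAddCommGroup E'] [NormedSpace ℝ E']
  {V : Type*} [TopologicalSpace V] [ChartedSpace E' V] [IsManifold 𝓘(ℝ, E') ∞ V]

lemma mem_chartAt_source_real (s t : ℝ) : t ∈ (chartAt ℝ s).source := by
  rw [chartAt_self_eq]
  exact mem_univ t

lemma extChartAt_real (s t : ℝ) : extChartAt 𝓘(ℝ, ℝ) s t = t := by
  rw [extChartAt_model_space_eq_id]
  rfl

lemma tangentCoord_real (s t : ℝ) (u : TangentSpace 𝓘(ℝ, ℝ) t) : tangentCoord s ⟨t, u⟩ = u := by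
  rw [tangentCoord_eq_mfderiv (mem_chartAt_source_real s t), extChartAt_model_space_eq_id]
  simp only [PartialEquiv.refl_coe, mfderiv_id]
  rfl

lemma tangentCoord_velocity {γ : ℝ → M} {s t : ℝ} (hx : γ t ∈ (chartAt E (γ s)).source)
    (hγ : MDifferentiableAt 𝓘(ℝ, ℝ) 𝓘(ℝ, E) γ t) :
    tangentCoord (γ s) ⟨γ t, velocity γ t⟩ = fderiv ℝ (localMap (E := E) γ s) t 1 :=
  (tangentCoord_mfderiv_localMap (mem_chartAt_source_real s t) hx hγ _).trans
    congr(fderiv ℝ (localMap (E := E) γ s) $(extChartAt_real s t) $(tangentCoord_real s t _))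

lemma tangentCoord_covDerivAlong_curve [FiniteDimensional ℝ E] (g : LorentzMetric E M)
    {γ : ℝ → M} {s : ℝ} (hγ : MDifferentiableAt 𝓘(ℝ, ℝ) 𝓘(ℝ, E) γ s)
    {W : Π t : ℝ, TangentSpace 𝓘(ℝ, E) (γ t)} {W' : ℝ → E}
    (hW' : DifferentiableAt ℝ W' s) (hW : ∀ᶠ t in 𝓝 s, tangentCoord (γ s) ⟨γ t, W t⟩ = W' t) :
    (covDerivAlong (E' := ℝ) g γ W s (1 : ℝ) : E) =
      christoffelDeriv (g.localChristoffel (γ s)) (localMap γ s) W' 1 s := by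
  have h := tangentCoord_covDerivAlong_localMap g (mem_chartAt_source_real s s)
    (mem_chart_source E (γ s)) hγ (W' := W') (by rwa [extChartAt_real])
    (by simpa only [extChartAt_real] using hW) (1 : ℝ)
  rw [tangentCoord_self] at h
  exact h.trans congr(christoffelDeriv (g.localChristoffel (γ s)) (localMap γ s) W'
    $(tangentCoord_real s s _) $(extChartAt_real s s))

/-- The chain rule applied twice. It separates the acceleration of `φ ∘ c` into the Hessian term and
the tangent term `Dφ(c'')`. -/
lemma fderiv_fderiv_comp_curve {φ : E' → E} {c : ℝ → E'} {t : ℝ} (hφ : ContDiffAt ℝ 2 φ (c t))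
    (hc : ContDiffAt ℝ 2 c t) :
    DifferentiableAt ℝ (fun t ↦ fderiv ℝ (φ ∘ c) t 1) t ∧
    fderiv ℝ (fun t ↦ fderiv ℝ (φ ∘ c) t 1) t 1 =
      fderiv ℝ (fderiv ℝ φ) (c t) (fderiv ℝ c t 1) (fderiv ℝ c t 1) +
        fderiv ℝ φ (c t) (fderiv ℝ (fun t ↦ fderiv ℝ c t 1) t 1) := by
  have hφ1 := ((hφ.of_le (m := 1) (by norm_num)).eventually (by simp))
  have hc1 := ((hc.of_le (m := 1) (by norm_num)).eventually (by simp))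
  have h : (fun t ↦ fderiv ℝ (φ ∘ c) t 1) =ᶠ[𝓝 t] fun t ↦ fderiv ℝ φ (c t) (fderiv ℝ c t 1) := by
    filter_upwards [hc1, hc.continuousAt.eventually hφ1] with t h1 h2
    rw [fderiv_comp t (h2.differentiableAt (by simp)) (h1.differentiableAt (by simp))]
    rfl
  have h1 : HasFDerivAt (fun t ↦ fderiv ℝ φ (c t)) _ t :=
    ((hφ.fderiv_right (m := 1) (by norm_num)).differentiableAt (by simp)).hasFDerivAt.comp t
      (hc.differentiableAt (by simp)).hasFDerivAt
  have h2 := (((hc.fderiv_right (m := 1) (by norm_num)).differentiableAt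
    (by simp)).clm_apply (differentiableAt_const (1 : ℝ))).hasFDerivAt
  have h3 := (h1.clm_apply h2).congr_of_eventuallyEq h
  refine ⟨h3.differentiableAt, ?_⟩
  rw [h3.fderiv]
  simp [add_comm]

/-- The second derivative of a totally geodesic immersion, corrected by the Christoffel symbols,
is tangent to the image. -/
lemma christoffel_mem_range_of_isTotallyGeodesic [FiniteDimensional ℝ E] (g : LorentzMetric E M)
    {f : V → M} (hf : ContMDiff 𝓘(ℝ, E') 𝓘(ℝ, E) ∞ f) (hgeo : IsTotallyGeodesic (E' := E') g f)
    (p : V) (v : E') :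
    fderiv ℝ (fderiv ℝ (localMap (E := E) f p)) (extChartAt 𝓘(ℝ, E') p p) v v +
      g.localChristoffel (f p) (extChartAt 𝓘(ℝ, E) (f p) (f p))
        (fderiv ℝ (localMap (E := E) f p) (extChartAt 𝓘(ℝ, E') p p) v)
        (fderiv ℝ (localMap (E := E) f p) (extChartAt 𝓘(ℝ, E') p p) v) ∈
      (fderiv ℝ (localMap (E := E) f p) (extChartAt 𝓘(ℝ, E') p p)).range := by
  obtain ⟨ε, hε, c, hc, hcv, -, hγ⟩ := hgeo (⟨p, (v : TangentSpace 𝓘(ℝ, E') p)⟩)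
  obtain ⟨rfl, hv⟩ : c 0 = p ∧ tangentCoord (c 0) ⟨c 0, velocity c 0⟩ = v := by
    have h1 : c 0 = p := congr(($hcv).1)
    refine ⟨h1, ?_⟩
    rw [hcv, h1]
    exact tangentCoord_self p _
  have hIoo : Ioo (-ε) ε ∈ 𝓝 (0 : ℝ) := Ioo_mem_nhds (by linarith) hε
  have hct (t : ℝ) (ht : t ∈ Ioo (-ε) ε) : ContMDiffAt 𝓘(ℝ, ℝ) 𝓘(ℝ, E') 2 c t :=
    hc.contMDiffAt (Ioo_mem_nhds ht.1 ht.2)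
  have h0 : (0 : ℝ) ∈ Ioo (-ε) ε := by constructor <;> linarith
  have hφ : ContDiffAt ℝ 2 (localMap (E := E) f (c 0)) (extChartAt 𝓘(ℝ, E') (c 0) (c 0)) :=
    contDiffAt_localMap (n := 2) (mem_chart_source E' _) (mem_chart_source E _)
      ((hf _).of_le (mod_cast le_top))
  have hr := mem_chartAt_source_real 0
  have hext := extChartAt_real 0
  set C : ℝ → E' := localMap c 0 with hC
  have hcd : ContDiffAt ℝ 2 C 0 := by
    have := contDiffAt_localMap (n := 2) (hr 0) (mem_chart_source E' _) (hct 0 h0)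
    rwa [hext] at this
  have hfd (q : V) : MDifferentiableAt 𝓘(ℝ, E') 𝓘(ℝ, E) f q := (hf q).mdifferentiableAt (by simp)
  have hcmd (t : ℝ) (ht : t ∈ Ioo (-ε) ε) := (hct t ht).mdifferentiableAt (by simp)
  have hfc (t : ℝ) (ht : t ∈ Ioo (-ε) ε) : MDifferentiableAt 𝓘(ℝ, ℝ) 𝓘(ℝ, E) (f ∘ c) t :=
    (hfd _).comp t (hcmd t ht)
  have hc0 : C 0 = extChartAt 𝓘(ℝ, E') (c 0) (c 0) := by
    have := localMap_extChartAt (E := E') c (hr 0)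
    rwa [hext] at this
  have hsrc := (hcmd 0 h0).continuousAt.eventually
    (eventually_mem_sources (E' := E') (E := E) (hfd (c 0)).continuousAt)
  have hcomp : localMap (E := E) (E' := ℝ) (f ∘ c) 0 =ᶠ[𝓝 0]
      localMap (E := E) f (c 0) ∘ C := by
    filter_upwards [hsrc] with t ht
    have h1 := localMap_extChartAt (E := E') c (hr t)
    have h2 := localMap_extChartAt (E := E) (f ∘ c) (hr t)
    rw [hext] at h1 h2
    rw [Function.comp_apply, hC, h1, h2, localMap_extChartAt f ht.1]
    rfl
  have hvel : fderiv ℝ (C) 0 1 = v := by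
    rw [← hv, tangentCoord_velocity (mem_chart_source E' _) (hcmd 0 h0)]
  have hsecond := fderiv_fderiv_comp_curve (hc0 ▸ hφ) hcd
  rw [hc0, hvel] at hsecond
  have hW : ∀ᶠ t in 𝓝 (0 : ℝ), tangentCoord ((f ∘ c) 0) ⟨(f ∘ c) t, velocity (f ∘ c) t⟩ =
      fderiv ℝ (localMap (E := E) f (c 0) ∘ C) t 1 := by
    filter_upwards [hIoo, hsrc, hcomp.eventuallyEq_nhds] with t ht hs hco
    rw [tangentCoord_velocity hs.2 (hfc t ht), hco.fderiv_eq]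
  -- The geodesic equation at time `0`, read in the chart at `f (c 0)`.
  have hD : christoffelDeriv (g.localChristoffel (f (c 0))) (localMap (f ∘ c) 0)
      (fun t ↦ fderiv ℝ (localMap (E := E) f (c 0) ∘ C) t 1) 1 0 = (0 : E) :=
    (tangentCoord_covDerivAlong_curve g (hfc 0 h0) hsecond.1 hW).symm.trans (hγ 0 h0)
  have hz : (localMap (E := E) f (c 0) ∘ C) 0 = extChartAt 𝓘(ℝ, E) (f (c 0)) (f (c 0)) := by
    rw [Function.comp_apply, hc0, localMap_extChartAt f (mem_chart_source E' _)]
  have hchain : fderiv ℝ (localMap (E := E) f (c 0) ∘ C) 0 1 =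
      fderiv ℝ (localMap (E := E) f (c 0)) (extChartAt 𝓘(ℝ, E') (c 0) (c 0)) v := by
    rw [fderiv_comp _ (by rw [hc0]; exact hφ.differentiableAt (by simp))
      (hcd.differentiableAt (by simp)), ContinuousLinearMap.comp_apply, hvel, hc0]
  rw [christoffelDeriv, hsecond.2, hcomp.fderiv_eq, hcomp.self_of_nhds, hchain, hz] at hD
  -- The preimage is `-c''(0)` in the chart of `V`.
  refine ⟨-(fderiv ℝ (fun t ↦ fderiv ℝ C t 1) 0 1), ?_⟩
  rw [ContinuousLinearMap.coe_coe, map_neg, neg_eq_iff_add_eq_zero, ← hD]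
  abel

/-- Polarized form of `christoffel_mem_range_of_isTotallyGeodesic`. -/
lemma christoffel_mem_range_of_isTotallyGeodesic' [FiniteDimensional ℝ E] (g : LorentzMetric E M)
    {f : V → M} (hf : ContMDiff 𝓘(ℝ, E') 𝓘(ℝ, E) ∞ f) (hgeo : IsTotallyGeodesic (E' := E') g f)
    (p : V) (u v : E') :
    fderiv ℝ (fderiv ℝ (localMap (E := E) f p)) (extChartAt 𝓘(ℝ, E') p p) u v +
      g.localChristoffel (f p) (extChartAt 𝓘(ℝ, E) (f p) (f p))
        (fderiv ℝ (localMap (E := E) f p) (extChartAt 𝓘(ℝ, E') p p) v)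
        (fderiv ℝ (localMap (E := E) f p) (extChartAt 𝓘(ℝ, E') p p) u) ∈
      (fderiv ℝ (localMap (E := E) f p) (extChartAt 𝓘(ℝ, E') p p)).range := by
  have hφ : ContDiffAt ℝ 2 (localMap (E := E) f p) (extChartAt 𝓘(ℝ, E') p p) :=
    contDiffAt_localMap (n := 2) (mem_chart_source E' p) (mem_chart_source E (f p))
      ((hf _).of_le (mod_cast le_top))
  -- Polarization `(Q(u + v) - Q(u) - Q(v)) / 2` of the quadratic expression, inside the range of
  -- `Dφ`.
  have h := Submodule.smul_mem _ (1 / 2 : ℝ) (Submodule.sub_mem _ (Submodule.sub_mem _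
    (christoffel_mem_range_of_isTotallyGeodesic g hf hgeo p (u + v))
    (christoffel_mem_range_of_isTotallyGeodesic g hf hgeo p u))
    (christoffel_mem_range_of_isTotallyGeodesic g hf hgeo p v))
  convert h using 1
  have h1 := (hφ.isSymmSndFDerivAt (by simp)).eq v u
  have h2 := g.localChristoffel_symm (mem_chart_source E (f p))
    (fderiv ℝ (localMap (E := E) f p) (extChartAt 𝓘(ℝ, E') p p) u)
    (fderiv ℝ (localMap (E := E) f p) (extChartAt 𝓘(ℝ, E') p p) v)
  simp only [map_add, add_apply]
  rw [h1, h2]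
  module

/-- The covariant derivative of a tangent vector field along a totally geodesic immersion is
tangent to the image. -/
lemma exists_mfderiv_eq_covDerivAlong [FiniteDimensional ℝ E] (g : LorentzMetric E M)
    {f : V → M} (hf : ContMDiff 𝓘(ℝ, E') 𝓘(ℝ, E) ∞ f) (hgeo : IsTotallyGeodesic (E' := E') g f)
    {p : V} {Y : Π q : V, TangentSpace 𝓘(ℝ, E') q} (hY : MDiffAt (T% Y) p)
    (u : TangentSpace 𝓘(ℝ, E') p) :
    ∃ e : TangentSpace 𝓘(ℝ, E') p,
      mfderiv 𝓘(ℝ, E') 𝓘(ℝ, E) f p e = covDerivAlong g f (pushField f Y) p u := by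
  have hp := mem_chart_source E' p
  have hxp := mem_chart_source E (f p)
  have hfd (q : V) : MDifferentiableAt 𝓘(ℝ, E') 𝓘(ℝ, E) f q := (hf q).mdifferentiableAt (by simp)
  have hφ : ContDiffAt ℝ 2 (localMap (E := E) f p) (extChartAt 𝓘(ℝ, E') p p) :=
    contDiffAt_localMap (n := 2) hp hxp ((hf _).of_le (mod_cast le_top))
  have hpol := christoffel_mem_range_of_isTotallyGeodesic' g hf hgeo p
  obtain ⟨Y', hYd, hYe⟩ := ((mdiffAt_iff_tangentCoord hp).1 hY).exists_eq_comp_extChartAt hp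
  have hφ' : DifferentiableAt ℝ (fderiv ℝ (localMap (E := E) f p))
      (extChartAt 𝓘(ℝ, E') p p) :=
    (hφ.fderiv_right (m := 1) (by norm_num)).differentiableAt (by simp)
  have hD := tangentCoord_covDerivAlong_pushField g hf hp hxp hYd hYe u
  rw [christoffelDeriv, (hφ'.hasFDerivAt.clm_apply hYd.hasFDerivAt).fderiv,
    localMap_extChartAt f hp] at hD
  obtain ⟨e, he⟩ := hpol (tangentCoord p ⟨p, u⟩) (Y' (extChartAt 𝓘(ℝ, E') p p))
  rw [ContinuousLinearMap.coe_coe] at he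
  -- By the Leibniz rule the derivative of `Dφ(Y')` is `D²φ(u, Y') + Dφ(∂_u Y')`: the first summand
  -- with the Christoffel term is `Dφ e`, and the second is already tangent.
  let e' : TangentSpace 𝓘(ℝ, E') p :=
    e + fderiv ℝ Y' (extChartAt 𝓘(ℝ, E') p p) (tangentCoord p ⟨p, u⟩)
  have he' : tangentCoord p ⟨p, e'⟩ =
    e + fderiv ℝ Y' (extChartAt 𝓘(ℝ, E') p p) (tangentCoord p ⟨p, u⟩) := tangentCoord_self p e'
  refine ⟨e', tangentCoord_injective hxp ?_⟩
  rw [hD, tangentCoord_mfderiv_localMap hp hxp (hfd p), he', map_add, he]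
  simp
  abel

end TotallyGeodesic

/-! ### The restricted connection, its smoothness, and isotropic tangent vectors -/

section InducedConnection

variable {E : Type*} [NormedAddCommGroup E] [NormedSpace ℝ E]
  {M : Type*} [TopologicalSpace M] [ChartedSpace E M] [IsManifold 𝓘(ℝ, E) ∞ M]
  {E' : Type*} [NormedAddCommGroup E'] [NormedSpace ℝ E']
  {V : Type*} [TopologicalSpace V] [ChartedSpace E' V] [IsManifold 𝓘(ℝ, E') ∞ V]

lemma covDerivAlong_add (g : LorentzMetric E M) {f : V → M} {p : V} (hf : ContinuousAt f p)
    {W W' : Π q : V, TangentSpace 𝓘(ℝ, E) (f q)}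
    (hW : MDifferentiableAt 𝓘(ℝ, E') 𝓘(ℝ, E) (fun q ↦ tangentCoord (f p) ⟨f q, W q⟩) p)
    (hW' : MDifferentiableAt 𝓘(ℝ, E') 𝓘(ℝ, E) (fun q ↦ tangentCoord (f p) ⟨f q, W' q⟩) p)
    (u : TangentSpace 𝓘(ℝ, E') p) :
    covDerivAlong g f (fun q ↦ W q + W' q) p u =
      covDerivAlong g f W p u + covDerivAlong g f W' p u := by
  have h : (fun q ↦ tangentCoord (f p) ⟨f q, W q + W' q⟩) =ᶠ[𝓝 p]
      (fun q ↦ tangentCoord (f p) ⟨f q, W q⟩) + fun q ↦ tangentCoord (f p) ⟨f q, W' q⟩ := by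
    filter_upwards [hf.eventually (eventually_mem_baseSet (E := E) (f p))] with q hq
    exact tangentCoord_add hq _ _
  have h1 := congr($(mvfderiv_congr h) u).trans
    congr($(mvfderiv_add hW hW') u)
  have h2 := congr($(g.christoffel_add (f p) (W p) (W' p)) (mfderiv 𝓘(ℝ, E') 𝓘(ℝ, E) f p u))
  exact congr($h1 + $h2).trans (add_add_add_comm (G := E) _ _ _ _)

lemma covDerivAlong_smul (g : LorentzMetric E M) {f : V → M} {p : V} (hf : ContinuousAt f p)
    {W : Π q : V, TangentSpace 𝓘(ℝ, E) (f q)} {c : V → ℝ}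
    (hc : MDifferentiableAt 𝓘(ℝ, E') 𝓘(ℝ, ℝ) c p)
    (hW : MDifferentiableAt 𝓘(ℝ, E') 𝓘(ℝ, E) (fun q ↦ tangentCoord (f p) ⟨f q, W q⟩) p)
    (u : TangentSpace 𝓘(ℝ, E') p) :
    covDerivAlong g f (fun q ↦ c q • W q) p u =
      c p • covDerivAlong g f W p u + mvfderiv 𝓘(ℝ, E') c p u • W p := by
  have h : (fun q ↦ tangentCoord (f p) ⟨f q, c q • W q⟩) =ᶠ[𝓝 p]
      c • (fun q ↦ tangentCoord (f p) ⟨f q, W q⟩) := by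
    filter_upwards [hf.eventually (eventually_mem_baseSet (E := E) (f p))] with q hq
    exact tangentCoord_smul hq _ _
  have h1 := (mvfderiv_congr h).trans (mvfderiv_smul hc hW)
  rw [tangentCoord_self] at h1
  have h2 := congr($(g.christoffel_smul (f p) (c p) (W p)) (mfderiv 𝓘(ℝ, E') 𝓘(ℝ, E) f p u))
  refine congr($h1 u + $h2).trans ((add_right_comm (G := E) _ _ _).trans ?_)
  exact congr($((smul_add (A := E) (c p) _ _).symm) + _)

lemma exists_leftInverse_of_injective [FiniteDimensional ℝ E] {A : E' →L[ℝ] E}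
    (hA : Function.Injective A) : ∃ L : E →L[ℝ] E', ∀ u, L (A u) = u := by
  obtain ⟨L, hL⟩ := (A : E' →ₗ[ℝ] E).exists_leftInverse_of_injective (LinearMap.ker_eq_bot.2 hA)
  exact ⟨L.toContinuousLinearMap, fun u ↦ congr($hL u)⟩

lemma mdifferentiableAt_pushField {f : V → M} (hf : ContMDiff 𝓘(ℝ, E') 𝓘(ℝ, E) ∞ f) {p : V}
    {Y : Π q : V, TangentSpace 𝓘(ℝ, E') q} (hY : MDiffAt (T% Y) p) :
    MDifferentiableAt 𝓘(ℝ, E') 𝓘(ℝ, E)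
      (fun q ↦ tangentCoord (f p) ⟨f q, pushField (E := E) f Y q⟩) p := by
  have hp := mem_chart_source E' p
  have hfd (q : V) : MDifferentiableAt 𝓘(ℝ, E') 𝓘(ℝ, E) f q := (hf q).mdifferentiableAt (by simp)
  obtain ⟨Y', hYd, hYe⟩ := ((mdiffAt_iff_tangentCoord hp).1 hY).exists_eq_comp_extChartAt hp
  have hφ : ContDiffAt ℝ 2 (localMap (E := E) f p) (extChartAt 𝓘(ℝ, E') p p) :=
    contDiffAt_localMap (n := 2) hp (mem_chart_source E (f p)) ((hf _).of_le (mod_cast le_top))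
  have hd := ((hφ.fderiv_right (m := 1) (by norm_num)).differentiableAt (by simp)).clm_apply hYd
  refine (mvfderiv_comp_extChartAt hp hd).1.congr_of_eventuallyEq ?_
  filter_upwards [hYe, eventually_mem_sources (E := E) (E' := E') (hfd p).continuousAt]
    with q h1 ⟨hq, hx⟩
  rw [pushField, tangentCoord_mfderiv_localMap hq hx (hfd q), h1]
  rfl

/-- A totally geodesic immersion into a Lorentzian manifold induces a connection. -/
lemma exists_covariantDerivative_of_isTotallyGeodesic [FiniteDimensional ℝ E]
    (g : LorentzMetric E M) {f : V → M} (hf : ContMDiff 𝓘(ℝ, E') 𝓘(ℝ, E) ∞ f)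
    (hi : ∀ p, Function.Injective (mfderiv 𝓘(ℝ, E') 𝓘(ℝ, E) f p))
    (hgeo : IsTotallyGeodesic (E' := E') g f) :
    ∃ cov : CovariantDerivative 𝓘(ℝ, E') E' (TangentSpace 𝓘(ℝ, E') : V → Type _),
      ∀ (p : V) (u : TangentSpace 𝓘(ℝ, E') p) (Y : Π q : V, TangentSpace 𝓘(ℝ, E') q),
        MDiffAt (T% Y) p →
          mfderiv 𝓘(ℝ, E') 𝓘(ℝ, E) f p (cov Y p u) = covDerivAlong g f (pushField f Y) p u := by
  have hfc (p : V) : ContinuousAt f p := (hf p).continuousAt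
  -- An arbitrary pointwise choice suffices: on tangent vectors every left inverse takes the same
  -- value, so smoothness can be proved separately.
  choose L hL using fun p ↦ exists_leftInverse_of_injective (E := E) (E' := E') (hi p)
  -- The covariant derivative along `f` as a continuous linear map of the direction, defined for all
  -- fields; it is tangent-valued when the field is differentiable at `p`.
  let D (Y : Π q : V, TangentSpace 𝓘(ℝ, E') q) (p : V) : E' →L[ℝ] E :=
    letI d : E' →L[ℝ] E :=
      mvfderiv 𝓘(ℝ, E') (fun q ↦ tangentCoord (f p) ⟨f q, pushField (E := E) f Y q⟩) p
    letI m : E' →L[ℝ] E := mfderiv 𝓘(ℝ, E') 𝓘(ℝ, E) f p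
    d + (g.christoffel (f p) (pushField (E := E) f Y p)).comp m
  let C (Y : Π q : V, TangentSpace 𝓘(ℝ, E') q) (p : V) :
      TangentSpace 𝓘(ℝ, E') p →L[ℝ] TangentSpace 𝓘(ℝ, E') p := (L p).comp (D Y p)
  have key (p : V) (u : TangentSpace 𝓘(ℝ, E') p) (Y : Π q : V, TangentSpace 𝓘(ℝ, E') q)
      (hY : MDiffAt (T% Y) p) :
      mfderiv 𝓘(ℝ, E') 𝓘(ℝ, E) f p (C Y p u) = covDerivAlong g f (pushField f Y) p u := by
    obtain ⟨e, he⟩ := exists_mfderiv_eq_covDerivAlong g hf hgeo hY u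
    have h1 : C Y p u = L p (covDerivAlong g f (pushField f Y) p u) := rfl
    have h2 : L p (mfderiv 𝓘(ℝ, E') 𝓘(ℝ, E) f p e) = e := hL p e
    rw [h1, ← he, h2]
  refine ⟨⟨C, ⟨?_, ?_⟩⟩, key⟩
  · intro σ σ' p hσ hσ' _
    ext u
    -- The axioms are tested after applying the injective differential, where they become those of
    -- the derivative along `f`.
    refine hi p ?_
    have hp : pushField (E := E) f (σ + σ') = fun q ↦ pushField f σ q + pushField f σ' q := by
      ext q
      exact map_add _ _ _
    rw [key p u _ (mdifferentiableAt_add_section hσ hσ'), add_apply, map_add,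
      key p u _ hσ, key p u _ hσ', hp]
    exact covDerivAlong_add g (hfc p) (mdifferentiableAt_pushField hf hσ)
      (mdifferentiableAt_pushField hf hσ') u
  · intro σ c p hσ hc _
    ext u
    refine hi p ?_
    have hp : pushField (E := E) f (c • σ) = fun q ↦ c q • pushField f σ q := by
      ext q
      exact map_smul _ _ _
    rw [key p u _ (hc.smul_section hσ), add_apply, map_add, smul_apply, map_smul, key p u _ hσ, hp,
      ContinuousLinearMap.smulRight_apply, map_smul]
    exact covDerivAlong_smul g (hfc p) hc (mdifferentiableAt_pushField hf hσ) u

/-- A connection on an immersed submanifold which is mapped to the Levi-Civita connection of the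
ambient manifold is smooth. -/
lemma contMDiffCovariantDerivative_of_mfderiv_eq [FiniteDimensional ℝ E] [FiniteDimensional ℝ E']
    (g : LorentzMetric E M) {f : V → M} (hf : ContMDiff 𝓘(ℝ, E') 𝓘(ℝ, E) ∞ f)
    (hi : ∀ p, Function.Injective (mfderiv 𝓘(ℝ, E') 𝓘(ℝ, E) f p))
    (cov : CovariantDerivative 𝓘(ℝ, E') E' (TangentSpace 𝓘(ℝ, E') : V → Type _))
    (hcov : ∀ (p : V) (u : TangentSpace 𝓘(ℝ, E') p) (Y : Π q : V, TangentSpace 𝓘(ℝ, E') q),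
      MDiffAt (T% Y) p →
        mfderiv 𝓘(ℝ, E') 𝓘(ℝ, E) f p (cov Y p u) = covDerivAlong g f (pushField f Y) p u) :
    cov.ContMDiffCovariantDerivative ∞ := by
  refine ⟨⟨fun {Y} hY ↦ ?_⟩⟩
  rw [contMDiffOn_univ] at hY ⊢
  intro p
  rw [contMDiffAt_section]
  have hp := mem_chart_source E' p
  have hxp := mem_chart_source E (f p)
  have hfd (q : V) : MDifferentiableAt 𝓘(ℝ, E') 𝓘(ℝ, E) f q := (hf q).mdifferentiableAt (by simp)
  have hYp : ContMDiffAt 𝓘(ℝ, E') 𝓘(ℝ, E') ∞ (fun q ↦ tangentCoord p ⟨q, Y q⟩) p :=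
    (contMDiffAt_section _).1 (hY p)
  obtain ⟨Y', hY'⟩ : ∃ Y' : E' → E',
    Y' = (fun q ↦ tangentCoord p ⟨q, Y q⟩) ∘ (extChartAt 𝓘(ℝ, E') p).symm := ⟨_, rfl⟩
  have hYs : ContDiffAt ℝ ∞ Y' (extChartAt 𝓘(ℝ, E') p p) := by
    rw [hY']
    exact (contMDiffAt_iff_comp_symm (n := ⊤) hp).1 hYp
  have hYm (q : V) : MDiffAt (T% Y) q := (hY q).mdifferentiableAt (by simp)
  have hYd {q : V} (hq : q ∈ (chartAt E' p).source) :
      DifferentiableAt ℝ Y' (extChartAt 𝓘(ℝ, E') p q) := by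
    rw [hY']
    exact (mdifferentiableAt_iff_comp_symm hq).1 ((mdiffAt_iff_tangentCoord hq).1 (hYm q))
  have hYe {q : V} (hq : q ∈ (chartAt E' p).source) :
      ∀ᶠ q' in 𝓝 q, tangentCoord p ⟨q', Y q'⟩ = Y' (extChartAt 𝓘(ℝ, E') p q') :=
    eventually_eq_of_eq_comp_symm hY' hq
  set φ : E' → E := localMap f p with hφdef
  have hφ : ContDiffAt ℝ ∞ φ (extChartAt 𝓘(ℝ, E') p p) :=
    contDiffAt_localMap (n := ⊤) hp hxp (hf p)
  have hφ' : ContDiffAt ℝ ∞ (fderiv ℝ φ) (extChartAt 𝓘(ℝ, E') p p) := hφ.fderiv_right (by simp)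
  have hΓ : ContDiffAt ℝ ∞ (fun z ↦ g.localChristoffel (f p) (φ z)) (extChartAt 𝓘(ℝ, E') p p) := by
    refine ContDiffAt.comp (g := g.localChristoffel (f p)) _ ?_ hφ
    rw [hφdef, localMap_extChartAt f hp]
    exact g.contDiffAt_localChristoffel hxp
  obtain ⟨B, hB, hBA⟩ := exists_contDiffAt_leftInverse hφ' (fderiv_localMap_injective (hfd p) (hi p))
  have hW : ContDiffAt ℝ ∞ (fun z ↦ fderiv ℝ φ z (Y' z)) (extChartAt 𝓘(ℝ, E') p p) :=
    hφ'.clm_apply hYs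
  -- The candidate for `∇Y` in the chart: the derivative along `φ`, pulled back by the smooth left
  -- inverse `B` of `Dφ`. The remaining lines identify it with `cov Y` near `p`.
  have hK : ContDiffAt ℝ ∞ (fun z ↦ (B z).comp (fderiv ℝ (fun z ↦ fderiv ℝ φ z (Y' z)) z +
      (g.localChristoffel (f p) (φ z) (fderiv ℝ φ z (Y' z))).comp (fderiv ℝ φ z)))
      (extChartAt 𝓘(ℝ, E') p p) :=
    hB.clm_comp ((hW.fderiv_right (by simp)).add ((hΓ.clm_apply hW).clm_comp hφ'))
  refine (hK.contMDiffAt.comp p contMDiffAt_extChartAt).congr_of_eventuallyEq ?_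
  filter_upwards [(continuousAt_extChartAt p).eventually hBA,
    eventually_mem_sources (E := E) (E' := E') (hfd p).continuousAt] with q hBq ⟨hq, hx⟩
  refine ContinuousLinearMap.ext fun u ↦ ?_
  have hb : q ∈ (trivializationAt E' (TangentSpace 𝓘(ℝ, E')) p).baseSet := by
    rwa [TangentBundle.trivializationAt_baseSet]
  have h1 : (trivializationAt (E' →L[ℝ] E') (fun x : V ↦ TangentSpace 𝓘(ℝ, E') x →L[ℝ]
      TangentSpace 𝓘(ℝ, E') x) p ⟨q, cov Y q⟩).2 u =
      tangentCoord p ⟨q, cov Y q (chartField p u q)⟩ := by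
    rw [hom_trivializationAt_apply]
    refine Eq.trans (b := (trivializationAt E' (TangentSpace 𝓘(ℝ, E')) p).continuousLinearMapAt ℝ q
      (cov Y q ((trivializationAt E' (TangentSpace 𝓘(ℝ, E')) p).symmL ℝ q u))) rfl ?_
    rw [Trivialization.continuousLinearMapAt_apply_of_mem _ _ hb, symmL_eq_chartField hq]
    rfl
  refine h1.trans ?_
  rw [← hBq (tangentCoord p ⟨q, cov Y q (chartField p u q)⟩),
    ← tangentCoord_mfderiv_localMap hq hx (hfd q),
    hcov q _ _ (hYm q),
    tangentCoord_covDerivAlong_pushField g hf hq hx (hYd hq) (hYe hq), tangentCoord_chartField hq]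
  rfl

/-- The degenerate direction is isotropic and orthogonal to `ξ`, so `f_* ξ` is a multiple of it and
inherits its orthogonality to the tangent hyperplane. -/
lemma IsLightlikeHypersurface.val_eq_zero_of_isotropic {g : LorentzMetric E M} {f : V → M}
    (hf : IsLightlikeHypersurface (E' := E') g f) {p : V} {ξ : TangentSpace 𝓘(ℝ, E') p}
    (hξ : g.val (f p) (mfderiv 𝓘(ℝ, E') 𝓘(ℝ, E) f p ξ) (mfderiv 𝓘(ℝ, E') 𝓘(ℝ, E) f p ξ) = 0)
    (x : TangentSpace 𝓘(ℝ, E') p) :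
    g.val (f p) (mfderiv 𝓘(ℝ, E') 𝓘(ℝ, E) f p ξ) (mfderiv 𝓘(ℝ, E') 𝓘(ℝ, E) f p x) = 0 := by
  obtain ⟨η, hη, h⟩ := hf.degenerate p
  have h0 : mfderiv 𝓘(ℝ, E') 𝓘(ℝ, E) f p η ≠ 0 := fun h' ↦
    hη (hf.immersion p (h'.trans (map_zero _).symm))
  obtain ⟨c, hc⟩ := g.exists_eq_smul_of_isotropic (f p) (h η) hξ (h ξ) h0
  rw [hc, map_smul, smul_apply, h x, smul_zero]

end InducedConnection

end

/-! ### The theorem -/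

theorem theorem7
    {E : Type*} [NormedAddCommGroup E] [NormedSpace ℝ E] [FiniteDimensional ℝ E]
    {M : Type*} [TopologicalSpace M] [T2Space M] [ChartedSpace E M] [IsManifold 𝓘(ℝ, E) ∞ M]
    {E' : Type*} [NormedAddCommGroup E'] [NormedSpace ℝ E'] [FiniteDimensional ℝ E']
    {V : Type*} [TopologicalSpace V] [T2Space V] [ChartedSpace E' V] [IsManifold 𝓘(ℝ, E') ∞ V]
    (g : LorentzMetric E M) (f : V → M)
    (hf : IsLightlikeHypersurface (E' := E') g f) (hgeo : IsTotallyGeodesic (E' := E') g f) :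
    -- the second fundamental tensor vanishes
    (∀ (p : V) (ξ x : TangentSpace 𝓘(ℝ, E') p) (Y : Π q : V, TangentSpace 𝓘(ℝ, E') q),
      g.val (f p) (mfderiv 𝓘(ℝ, E') 𝓘(ℝ, E) f p ξ) (mfderiv 𝓘(ℝ, E') 𝓘(ℝ, E) f p ξ) = 0 →
      MDiffAt (T% Y) p → secondFundamentalTensor g f p ξ x Y = 0) ∧
    -- the isotropic sectional curvature of every tangent isotropic plane vanishes
    (∀ (p : V) (n x : TangentSpace 𝓘(ℝ, E') p), n ≠ 0 →
      g.val (f p) (mfderiv 𝓘(ℝ, E') 𝓘(ℝ, E) f p n) (mfderiv 𝓘(ℝ, E') 𝓘(ℝ, E) f p n) = 0 →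
      g.val (f p) (mfderiv 𝓘(ℝ, E') 𝓘(ℝ, E) f p x) (mfderiv 𝓘(ℝ, E') 𝓘(ℝ, E) f p x) ≠ 0 →
      isotropicSectionalCurvature g (f p)
        (mfderiv 𝓘(ℝ, E') 𝓘(ℝ, E) f p n) (mfderiv 𝓘(ℝ, E') 𝓘(ℝ, E) f p x) = 0) ∧
    -- every isotropic normalization induces a smooth affine connection on the hypersurface,
    -- which is unique, and whose curvature tensor is the restriction of the ambient one
    ∀ N : IsotropicNormalization (E' := E') g f,
      ∃ cov : CovariantDerivative 𝓘(ℝ, E') E' (TangentSpace 𝓘(ℝ, E') : V → Type _),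
        cov.ContMDiffCovariantDerivative ∞ ∧ IsInducedConnection g f N cov ∧
        (∀ cov' : CovariantDerivative 𝓘(ℝ, E') E' (TangentSpace 𝓘(ℝ, E') : V → Type _),
          IsInducedConnection g f N cov' →
          ∀ (p : V) (Y : Π q : V, TangentSpace 𝓘(ℝ, E') q), MDiffAt (T% Y) p →
            cov' Y p = cov Y p) ∧
        ∀ (p : V) (x y z : TangentSpace 𝓘(ℝ, E') p),
          mfderiv 𝓘(ℝ, E') 𝓘(ℝ, E) f p (curvatureTensor cov p x y z) =
            curvatureTensor g.leviCivita (f p) (mfderiv 𝓘(ℝ, E') 𝓘(ℝ, E) f p x)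
              (mfderiv 𝓘(ℝ, E') 𝓘(ℝ, E) f p y) (mfderiv 𝓘(ℝ, E') 𝓘(ℝ, E) f p z) := by
  -- One connection, chosen before any normalization, serves all three claims.
  obtain ⟨cov, hcov⟩ := exists_covariantDerivative_of_isTotallyGeodesic g hf.contMDiff hf.immersion
    hgeo
  have hcurv (p : V) (x y z : TangentSpace 𝓘(ℝ, E') p) :
      mfderiv 𝓘(ℝ, E') 𝓘(ℝ, E) f p (curvatureTensor cov p x y z) =
        curvatureTensor g.leviCivita (f p) (mfderiv 𝓘(ℝ, E') 𝓘(ℝ, E) f p x)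
          (mfderiv 𝓘(ℝ, E') 𝓘(ℝ, E) f p y) (mfderiv 𝓘(ℝ, E') 𝓘(ℝ, E) f p z) :=
    tangentCoord_injective (mem_chart_source E (f p))
      ((tangentCoord_mfderiv_curvatureTensor g hf.contMDiff hf.immersion cov hcov p x y z).trans
        (g.tangentCoord_curvatureTensor (f p) _ _ _).symm)
  refine ⟨fun p ξ x Y hξ hY ↦ ?_, fun p n x _ hn _ ↦ ?_, fun N ↦ ⟨cov, ?_, ?_, ?_, hcurv⟩⟩
  · rw [secondFundamentalTensor, ← hcov p x Y hY, g.symm, hf.val_eq_zero_of_isotropic hξ, neg_zero]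
  · have h := g.curvatureTensor_skew (f p) (mfderiv 𝓘(ℝ, E') 𝓘(ℝ, E) f p x)
      (mfderiv 𝓘(ℝ, E') 𝓘(ℝ, E) f p n) (mfderiv 𝓘(ℝ, E') 𝓘(ℝ, E) f p n)
      (mfderiv 𝓘(ℝ, E') 𝓘(ℝ, E) f p x)
    -- `R(x, n)x` is the image of the intrinsic curvature, hence tangent and orthogonal to the
    -- isotropic `n`.
    rw [← hcurv p x n x, hf.val_eq_zero_of_isotropic hn, add_zero] at h
    rw [isotropicSectionalCurvature, h, zero_div]
  · exact contMDiffCovariantDerivative_of_mfderiv_eq g hf.contMDiff hf.immersion cov hcov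
  · intro p x Y hY
    -- The ambient derivative is already tangent, so its projection along any line changes nothing.
    rw [hcov p x Y hY, sub_self]
    exact Submodule.zero_mem _
  · intro cov' hcov' p Y hY
    obtain ⟨U, hU, n, -, hn⟩ := N.exists_section p
    obtain ⟨hline, -, hnt⟩ := hn p (mem_of_mem_nhds hU)
    ext x
    have h := hcov' p x Y hY
    rw [← hcov p x Y hY, ← map_sub, hline, Submodule.mem_span_singleton] at h
    obtain ⟨a, ha⟩ := h
    have ha0 : a = 0 := by
      by_contra ha0
      -- The difference of two induced connections is both tangent and on the normalizing line; a
      -- nonzero coefficient would make the line tangent.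
      refine hnt (a⁻¹ • (cov Y p x - cov' Y p x)) ?_
      rw [map_smul, ← ha, smul_smul, inv_mul_cancel₀ ha0, one_smul]
    rw [ha0, zero_smul] at ha
    exact (sub_eq_zero.1 (hf.immersion p (ha.symm.trans (map_zero _).symm))).symm
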